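/- Let $-1<q<1$ and let $\ell^2(\mathbb{Z})$ have canonical orthonormal basis $(e_j)_{j\in\mathbb{Z}}$. Let $\Gamma_q$ be the $q$-deformed Fock space over $\ell^2(\mathbb{Z})$: the completion of the linear span of a vacuum vector $\zeta_q$ (the tensor of length $0$) and of the elementary tensors $f_1\otimes\cdots\otimes f_n$ ($n\ge 1$, $f_j\in\ell^2(\mathbb{Z})$) with respect to the inner product $$\langle f_1\otimes\cdots\otimes f_m,\ g_1\otimes\cdots\otimes g_n\rangle_q=\delta_{n,m}\sum_{\pi\in S_n}q^{i(\pi)}\langle f_1,g_{\pi(1)}\rangle\cdots\langle f_n,g_{\pi(n)}\rangle ,$$ where $i(\pi)$ is the number of inversions of $\pi$. Inner products are linear in the first variable. For $j\in\mathbb{Z}$ let $l_j$ be the annihilator on $\Gamma_q$, that is, the bounded operator with $$l_j\zeta_q=0,\qquad l_j(f_1\otimes\cdots\otimes f_n)=\sum_{k=1}^n q^{k-1}\langle f_k,e_j\rangle\, f_1\otimes\cdots\otimes f_{k-1}\otimes f_{k+1}\otimes\cdots\otimes f_n ,$$ and let $\mathfrak{R}_q\subset\mathcal{B}(\Gamma_q)$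 be the unital C*-algebra generated by $\{l_j : j\in\mathbb{Z}\}$. For a permutation $\sigma$ of $\mathbb{Z}$ let $U_\sigma$ be the unitary operator on $\Gamma_q$ with $U_\sigma\zeta_q=\zeta_q$ and $U_\sigma(e_{i_1}\otimes\cdots\otimes e_{i_k})=e_{\sigma(i_1)}\otimes\cdots\otimes e_{\sigma(i_k)}$. Let $\mathbb{P}_{\mathbb{Z}}$ be the group of permutations of $\mathbb{Z}$ that fix all but finitely many integers, let $\tau(i)=i+1$, and let $\mathbb{L}_{\mathbb{Z}}$ be the monoid of strictly increasing maps $g:\mathbb{Z}\to\mathbb{Z}$; for $g\in\mathbb{L}_{\mathbb{Z}}$ let $\Lambda_g$ be the unital $*$-endomorphism of $\mathfrak{R}_q$ determined by $\Lambda_g(l_j)=l_{g(j)}$ for all $j\in\mathbb{Z}$. Then $$\{X\in\mathfrak{R}_q : U_\sigma XU_\sigma^*=X \text{ for all } \sigma\in\mathbb{P}_{\mathbb{Z}}\}=\mathbb{C}I,$$ $$\{X\in\mathfrak{R}_q : U_\tau XU_\tau^*=X\}=\mathbb{C}I,$$ $$\{X\in\mathfrak{R}_q : \Lambda_g(X)=X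 \text{ for all } g\in\mathbb{L}_{\mathbb{Z}}\}=\mathbb{C}I.$$ -/

import Mathlib

open scoped ComplexConjugate ComplexOrder InnerProductSpace

set_option linter.unusedSectionVars false

noncomputable section

namespace QFock

/-- The number of inversions of a bijection between initial segments (of a permutation when
`n = m`; there is no such bijection when `n ≠ m`). -/
def inversions {n m : ℕ} (π : Fin n ≃ Fin m) : ℕ :=
  (Finset.univ.filter fun p : Fin n × Fin n => p.1 < p.2 ∧ π p.2 < π p.1).card

/-- A word `f₁ ⊗ ⋯ ⊗ fₙ` of vectors of `H`, of arbitrary length `n ≥ 0`; the empty word is the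
vacuum. -/
abbrev Word (H : Type*) := Σ n : ℕ, (Fin n → H)

variable {H : Type*} [NormedAddCommGroup H] [InnerProductSpace ℂ H]

/-- The `q`-deformed inner product of two elementary tensors,
`δ_{n,m} ∑_{π ∈ Sₙ} q^{i(π)} ∏ₖ ⟪fₖ, g_{π(k)}⟫`. The factor `δ_{n,m}` is built in: the sum over
bijections `Fin n ≃ Fin m` is empty when `n ≠ m`. As everywhere in Mathlib, inner products are
conjugate linear in the first argument. -/
def wordInner (q : ℝ) (v w : Word H) : ℂ :=
  ∑ π : Fin v.1 ≃ Fin w.1,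
    (q : ℂ) ^ inversions π * ∏ i, inner ℂ (v.2 i) (w.2 (π i))

/-- The sesquilinear extension of the `q`-deformed inner product to formal linear combinations
of elementary tensors. -/
def form (q : ℝ) (x y : Word H →₀ ℂ) : ℂ :=
  x.sum fun v a => y.sum fun w b => conj a * b * wordInner q v w

lemma inversions_symm {n m : ℕ} (π : Fin n ≃ Fin m) : inversions π.symm = inversions π := by
  unfold inversions
  refine Finset.card_bij' (fun p _ => (π.symm p.2, π.symm p.1)) (fun p _ => (π p.2, π p.1))
    ?_ ?_ ?_ ?_ <;> simp +contextual

lemma wordInner_conj (q : ℝ) (v w : Word H) : conj (wordInner q w v) = wordInner q v w := by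
  unfold wordInner
  rw [map_sum]
  refine Fintype.sum_equiv (Equiv.symmEquiv _ _) _ _ fun π => ?_
  change _ = (q : ℂ) ^ inversions π.symm * ∏ i, inner ℂ (v.2 i) (w.2 (π.symm i))
  simp only [map_mul, map_pow, Complex.conj_ofReal, map_prod, inner_conj_symm, inversions_symm]
  congr 1
  exact Fintype.prod_equiv π _ _ fun i => by simp

lemma posSemidef_gram' {ι E : Type*} [NormedAddCommGroup E] [InnerProductSpace ℂ E] (v : ι → E) :
    (Matrix.of fun i j => inner ℂ (v i) (v j) : Matrix ι ι ℂ).PosSemidef := by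
  refine ⟨Matrix.ext fun i j => by simp [Matrix.conjTranspose_apply], fun x => ?_⟩
  have : (x.sum fun i xi ↦ x.sum fun j xj ↦ star xi * inner ℂ (v i) (v j) * xj)
      = inner ℂ (x.sum fun i a => a • v i) (x.sum fun i a => a • v i) := by
    simp only [Finsupp.sum, sum_inner, inner_sum, inner_smul_left, inner_smul_right, Finset.mul_sum]
    rw [Finset.sum_comm]
    refine Finset.sum_congr rfl fun i _ => ?_
    exact Finset.sum_congr rfl fun j _ => by
      rw [← starRingEnd_apply]; ring
  simp only [Matrix.of_apply]
  rw [this, Complex.le_def]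
  exact ⟨inner_self_nonneg (𝕜 := ℂ), (inner_self_im (𝕜 := ℂ) _).symm⟩

lemma posSemidef_hadamard_prod {ι κ : Type*} (s : Finset κ) (A : κ → Matrix ι ι ℂ)
    (hA : ∀ k ∈ s, (A k).PosSemidef) :
    (Matrix.of fun i j => ∏ k ∈ s, A k i j : Matrix ι ι ℂ).PosSemidef := by
  classical
  induction s using Finset.induction_on with
  | empty =>
    convert posSemidef_gram' (fun _ : ι => (1 : ℂ)) using 3
    simp
  | insert a s ha ih =>
    have h : (Matrix.of fun i j => ∏ k ∈ insert a s, A k i j : Matrix ι ι ℂ) =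
        Matrix.hadamard (A a) (Matrix.of fun i j => ∏ k ∈ s, A k i j) := by
      ext i j
      simp [Finset.prod_insert ha, Matrix.hadamard_apply]
    rw [h]
    exact (hA a (by simp)).hadamard (ih fun k hk => hA k (by simp [hk]))

lemma posSemidef_sign {ι : Type*} {q : ℝ} (h1 : -1 ≤ q) (h2 : q ≤ 1) (p : ι → Prop)
    [DecidablePred p] :
    (Matrix.of fun i j => if (p i ↔ p j) then 1 else (q : ℂ) : Matrix ι ι ℂ).PosSemidef := by
  have hα : 0 ≤ (1 + q) / 2 := by linarith
  have hβ : 0 ≤ (1 - q) / 2 := by linarith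
  have := ((posSemidef_gram' (fun _ : ι => (1 : ℂ))).smul hα).add
    ((posSemidef_gram' (fun i : ι => if p i then (1 : ℂ) else -1)).smul hβ)
  convert this using 1
  ext i j
  by_cases hi : p i <;> by_cases hj : p j <;> simp [hi, hj] <;> ring

lemma inversions_eq {n : ℕ} (σ τ : Equiv.Perm (Fin n)) :
    inversions (σ.symm.trans τ) =
      ((Finset.univ.filter fun p : Fin n × Fin n => p.1 < p.2).filter
        fun p => ¬ (σ p.1 < σ p.2 ↔ τ p.1 < τ p.2)).card := by
  unfold inversions
  refine Finset.card_bij'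
    (fun p _ => if σ.symm p.1 < σ.symm p.2 then (σ.symm p.1, σ.symm p.2)
      else (σ.symm p.2, σ.symm p.1))
    (fun p _ => if σ p.1 < σ p.2 then (σ p.1, σ p.2) else (σ p.2, σ p.1)) ?_ ?_ ?_ ?_
  · rintro ⟨a, b⟩ h
    obtain ⟨a, rfl⟩ := σ.surjective a
    obtain ⟨b, rfl⟩ := σ.surjective b
    have h' : σ a < σ b ∧ τ b < τ a := by simpa using (Finset.mem_filter.1 h).2
    simp only [Equiv.symm_apply_apply]
    split_ifs <;> simp <;> grind
  · rintro ⟨a, b⟩ h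
    have h' : a < b ∧ ¬ (σ a < σ b ↔ τ a < τ b) := by simpa using h
    have h1 : σ a ≠ σ b := by simpa using h'.1.ne
    have h2 : τ a ≠ τ b := by simpa using h'.1.ne
    refine Finset.mem_filter.2 ⟨Finset.mem_univ _, ?_⟩
    simp only
    split_ifs <;> simp <;> grind
  · rintro ⟨a, b⟩ h
    obtain ⟨a, rfl⟩ := σ.surjective a
    obtain ⟨b, rfl⟩ := σ.surjective b
    have h' : σ a < σ b ∧ τ b < τ a := by simpa using (Finset.mem_filter.1 h).2
    simp only [Equiv.symm_apply_apply]
    split_ifs <;> simp <;> grind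
  · rintro ⟨a, b⟩ h
    have h' : a < b ∧ ¬ (σ a < σ b ↔ τ a < τ b) := by simpa using h
    have h1 : σ a ≠ σ b := by simpa using h'.1.ne
    simp only
    split_ifs <;> simp <;> grind

lemma posSemidef_perm (n : ℕ) {q : ℝ} (h1 : -1 ≤ q) (h2 : q ≤ 1) :
    (Matrix.of fun a b => (q : ℂ) ^ inversions (a.2.symm.trans b.2) *
        ∏ i, inner ℂ (a.1 (a.2 i)) (b.1 (b.2 i)) :
      Matrix ((Fin n → H) × Equiv.Perm (Fin n)) ((Fin n → H) × Equiv.Perm (Fin n)) ℂ).PosSemidef := by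
  have hA := posSemidef_hadamard_prod (ι := (Fin n → H) × Equiv.Perm (Fin n))
    (Finset.univ.filter fun p : Fin n × Fin n => p.1 < p.2)
    (fun p => Matrix.of fun a b => if (a.2 p.1 < a.2 p.2 ↔ b.2 p.1 < b.2 p.2) then 1 else (q : ℂ))
    (fun p _ => posSemidef_sign h1 h2
      (fun a : (Fin n → H) × Equiv.Perm (Fin n) => a.2 p.1 < a.2 p.2))
  have hB := posSemidef_hadamard_prod (ι := (Fin n → H) × Equiv.Perm (Fin n)) Finset.univ
    (fun i : Fin n => Matrix.of fun a b => inner ℂ (a.1 (a.2 i)) (b.1 (b.2 i)))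
    (fun i _ => posSemidef_gram' (fun a : (Fin n → H) × Equiv.Perm (Fin n) => a.1 (a.2 i)))
  refine (congrArg Matrix.PosSemidef ?_).mpr (hA.hadamard hB)
  ext a b
  simp only [Matrix.of_apply, Matrix.hadamard_apply, inversions_eq]
  congr 1
  rw [Finset.prod_ite]
  simp

lemma fixed_nonneg (n : ℕ) {q : ℝ} (h1 : -1 ≤ q) (h2 : q ≤ 1) (y : (Fin n → H) →₀ ℂ) :
    0 ≤ y.sum fun v a => y.sum fun w b => conj a * b * wordInner q ⟨n, v⟩ ⟨n, w⟩ := by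
  classical
  let f : y.support × Equiv.Perm (Fin n) → (Fin n → H) × Equiv.Perm (Fin n) := fun p => (p.1, p.2)
  have h := ((posSemidef_perm (H := H) n h1 h2).submatrix f).dotProduct_mulVec_nonneg
    (fun p => y p.1)
  have key : (star fun p : y.support × Equiv.Perm (Fin n) => y p.1) ⬝ᵥ
      (((Matrix.of fun a b => (q : ℂ) ^ inversions (a.2.symm.trans b.2) *
        ∏ i, inner ℂ (a.1 (a.2 i)) (b.1 (b.2 i)) :
      Matrix ((Fin n → H) × Equiv.Perm (Fin n)) ((Fin n → H) × Equiv.Perm (Fin n)) ℂ).submatrix f f).mulVec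
        (fun p => y p.1)) = (n.factorial : ℂ) *
      (y.sum fun v a => y.sum fun w b => conj a * b * wordInner q ⟨n, v⟩ ⟨n, w⟩) := by
    have step : ∀ (v w : Fin n → H) (σ : Equiv.Perm (Fin n)),
        ∑ τ : Equiv.Perm (Fin n), (q : ℂ) ^ inversions (σ.symm.trans τ) *
          ∏ i, inner ℂ (v (σ i)) (w (τ i)) = wordInner q ⟨n, v⟩ ⟨n, w⟩ := by
      intro v w σ
      unfold wordInner
      refine Fintype.sum_equiv (Equiv.mulRight σ⁻¹) _ _ fun τ => ?_
      have : Equiv.mulRight σ⁻¹ τ = σ.symm.trans τ := rfl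
      rw [this]
      congr 1
      exact Fintype.prod_equiv σ _ _ fun i => by simp
    simp only [dotProduct, Matrix.mulVec, Fintype.sum_prod_type, Matrix.submatrix_apply,
      Matrix.of_apply, f, Finsupp.sum, Pi.star_apply]
    rw [Finset.mul_sum, ← Finset.sum_coe_sort y.support]
    refine Finset.sum_congr rfl fun v _ => ?_
    have : ∀ σ : Equiv.Perm (Fin n), (∑ w : y.support, ∑ τ : Equiv.Perm (Fin n),
        (q : ℂ) ^ inversions (σ.symm.trans τ) *
          (∏ i, inner ℂ ((v : Fin n → H) (σ i)) ((w : Fin n → H) (τ i))) * y w) =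
        ∑ w : y.support, wordInner q ⟨n, (v : Fin n → H)⟩ ⟨n, (w : Fin n → H)⟩ * y w := by
      intro σ
      refine Finset.sum_congr rfl fun w _ => ?_
      rw [← Finset.sum_mul, step]
    simp only [this]
    rw [Finset.sum_const, Finset.card_univ, Fintype.card_perm, Fintype.card_fin, nsmul_eq_mul,
      ← Finset.sum_coe_sort y.support, Finset.mul_sum]
    congr 1
    refine Finset.sum_congr rfl fun w _ => ?_
    simp; ring
  rw [key] at h
  have hn : (0 : ℂ) ≤ ((n.factorial : ℝ)⁻¹ : ℝ) := by
    rw [Complex.zero_le_real]; positivity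
  have hn' : (n.factorial : ℂ) ≠ 0 := by exact_mod_cast n.factorial_ne_zero
  have h' := mul_nonneg hn h
  rwa [← mul_assoc, Complex.ofReal_inv, Complex.ofReal_natCast, inv_mul_cancel₀ hn', one_mul] at h'

lemma form_self_nonneg {q : ℝ} (h1 : -1 ≤ q) (h2 : q ≤ 1) (x : Word H →₀ ℂ) :
    0 ≤ form q x x := by
  classical
  unfold form
  rw [Finsupp.sigma_sum]
  refine Finset.sum_nonneg fun n hn => ?_
  convert fixed_nonneg n h1 h2 (x.split n) using 1
  refine Finsupp.sum_congr fun v _ => ?_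
  rw [Finsupp.sigma_sum]
  refine Finset.sum_eq_single n (fun m _ hm => ?_) (fun h => absurd hn h)
  refine Finset.sum_eq_zero fun w _ => ?_
  have : IsEmpty (Fin n ≃ Fin m) := ⟨fun e => hm (by simpa using (Fintype.card_congr e).symm)⟩
  simp [wordInner]

lemma card_castSucc_lt {m : ℕ} (k : Fin (m + 1)) :
    (∑ j : Fin m, if j.castSucc < k then 1 else 0) = (k : ℕ) := by
  rw [Finset.sum_boole]
  simp only [Nat.cast_id]
  have : (Finset.univ.filter fun j : Fin m => j.castSucc < k) =
      (Finset.univ.filter fun j : Fin m => (j : ℕ) < k) := by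
    ext j; simp [Fin.lt_def]
  rw [this, Fin.card_filter_val_lt]
  omega

lemma inversions_eq_sum {n m : ℕ} (π : Fin n ≃ Fin m) :
    inversions π = ∑ a, ∑ b, if a < b ∧ π b < π a then 1 else 0 := by
  rw [← Fintype.sum_prod_type', Finset.sum_boole]
  rfl

lemma inversions_succ {n m : ℕ} (π : Fin (n + 1) ≃ Fin (m + 1)) (ρ : Fin n ≃ Fin m)
    (h : ∀ i, π i.succ = (π 0).succAbove (ρ i)) :
    inversions π = (π 0 : ℕ) + inversions ρ := by
  rw [inversions_eq_sum, inversions_eq_sum, Fin.sum_univ_succ]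
  congr 1
  · rw [Fin.sum_univ_succ]
    simp only [lt_self_iff_false, and_self, if_false, Fin.succ_pos, true_and, zero_add, h,
      Fin.succAbove_lt_iff_castSucc_lt]
    rw [← card_castSucc_lt (π 0)]
    exact Fintype.sum_equiv ρ _ _ fun i => rfl
  · refine Finset.sum_congr rfl fun i _ => ?_
    rw [Fin.sum_univ_succ]
    simp [h, (Fin.strictMono_succAbove (π 0)).lt_iff_lt]

/-- The bijection of `Fin (n + 1)` with `Fin (m + 1)` that sends `0` to `k` and follows `ρ`
on the remaining points. -/
def permSplit (n m : ℕ) : (Fin (m + 1) × (Fin n ≃ Fin m)) → (Fin (n + 1) ≃ Fin (m + 1)) :=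
  fun p => (finSuccEquiv' 0).trans ((Equiv.optionCongr p.2).trans (finSuccEquiv' p.1).symm)

lemma permSplit_zero {n m : ℕ} (p) : permSplit n m p 0 = p.1 := by
  simp [permSplit]

lemma permSplit_succ {n m : ℕ} (p) (i : Fin n) :
    permSplit n m p i.succ = p.1.succAbove (p.2 i) := by
  have : finSuccEquiv' (0 : Fin (n + 1)) i.succ = some i := by
    rw [← Fin.zero_succAbove, finSuccEquiv'_succAbove]
  simp [permSplit, this]

lemma permSplit_bijective (n m : ℕ) : Function.Bijective (permSplit n m) := by
  constructor
  · rintro p p' h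
    have h0 : p.1 = p'.1 := by rw [← permSplit_zero p, h, permSplit_zero]
    refine Prod.ext h0 (Equiv.ext fun i => ?_)
    have := permSplit_succ p i
    rw [h, permSplit_succ, h0] at this
    exact (Fin.succAbove_right_injective this).symm
  · intro π
    let ρ : Fin n ≃ Fin m := (finSuccAboveEquiv 0).trans
      ((π.subtypeEquiv (p := fun x => x ≠ 0) (q := fun x => x ≠ π 0) (fun x => by simp)).trans
        (finSuccAboveEquiv (π 0)).symm)
    refine ⟨(π 0, ρ), Equiv.ext fun i => ?_⟩
    refine Fin.cases ?_ (fun i => ?_) i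
    · rw [permSplit_zero]
    · rw [permSplit_succ]
      have h2 : finSuccAboveEquiv (π 0) (ρ i) = ⟨π i.succ, by simp⟩ := by
        simp [ρ, finSuccAboveEquiv_apply]
      exact congrArg Subtype.val h2

/-- The word `f ⊗ f₁ ⊗ ⋯ ⊗ fₙ`. -/
def Word.cons (f : H) (w : Word H) : Word H := ⟨w.1 + 1, Fin.cons f w.2⟩

/-- The action of the annihilator on elementary tensors:
`l(f) (f₁ ⊗ ⋯ ⊗ fₙ) = ∑ₖ q^{k-1} ⟪f, fₖ⟫ f₁ ⊗ ⋯ ⊗ fₖ₋₁ ⊗ fₖ₊₁ ⊗ ⋯ ⊗ fₙ`, and `0` on the vacuum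
(the index `k` below starts at `0`). -/
def Word.annihilate (q : ℝ) (f : H) : Word H → (Word H →₀ ℂ)
  | ⟨0, _⟩ => 0
  | ⟨n + 1, w⟩ => ∑ k : Fin (n + 1),
      Finsupp.single ⟨n, fun i => w (k.succAbove i)⟩ ((q : ℂ) ^ (k : ℕ) * inner ℂ f (w k))

lemma wordInner_cons (q : ℝ) (f : H) (v w : Word H) :
    wordInner q (v.cons f) w =
      (Word.annihilate q f w).sum fun u b => b * wordInner q v u := by
  obtain ⟨n, v⟩ := v
  obtain ⟨m, w⟩ := w
  cases m with
  | zero =>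
    have : IsEmpty (Fin (n + 1) ≃ Fin 0) := ⟨fun e => (e 0).elim0⟩
    simp only [Word.annihilate, Finsupp.sum_zero_index]
    exact Finset.sum_of_isEmpty (ι := Fin (n + 1) ≃ Fin 0) _
  | succ m =>
    simp only [Word.annihilate]
    rw [← Finsupp.sum_finsetSum_index (by simp) (by intros; ring)]
    simp only [Finsupp.sum_single_index, zero_mul]
    unfold wordInner
    change (∑ π : Fin (n + 1) ≃ Fin (m + 1), (q : ℂ) ^ inversions π *
      ∏ i, inner ℂ ((Fin.cons f v : Fin (n + 1) → H) i) (w (π i))) = _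
    rw [← (Equiv.ofBijective _ (permSplit_bijective n m)).sum_comp, Fintype.sum_prod_type]
    refine Finset.sum_congr rfl fun k _ => ?_
    rw [Finset.mul_sum]
    refine Finset.sum_congr rfl fun ρ _ => ?_
    simp only [Equiv.ofBijective_apply]
    rw [inversions_succ _ ρ (fun i => by rw [permSplit_succ, permSplit_zero]), Fin.prod_univ_succ]
    simp only [permSplit_succ, permSplit_zero, Fin.cons_zero, Fin.cons_succ, pow_add]
    ring

lemma form_conj (q : ℝ) (x y : Word H →₀ ℂ) : conj (form q y x) = form q x y := by
  simp only [form, Finsupp.sum, map_sum, map_mul, Complex.conj_conj, wordInner_conj]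
  rw [Finset.sum_comm]
  exact Finset.sum_congr rfl fun _ _ => Finset.sum_congr rfl fun _ _ => by ring

lemma form_add_left (q : ℝ) (x y z : Word H →₀ ℂ) :
    form q (x + y) z = form q x z + form q y z := by
  unfold form
  refine Finsupp.sum_add_index' (by simp [Finsupp.sum]) (fun v a b => ?_)
  rw [← Finsupp.sum_add]
  simp [add_mul]

lemma form_smul_left (q : ℝ) (x y : Word H →₀ ℂ) (r : ℂ) :
    form q (r • x) y = conj r * form q x y := by
  unfold form
  rw [Finsupp.sum_smul_index (by simp [Finsupp.sum]), Finsupp.mul_sum]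
  refine Finsupp.sum_congr fun v _ => ?_
  rw [Finsupp.mul_sum]
  exact Finsupp.sum_congr fun w _ => by rw [map_mul]; ring

lemma form_add_right (q : ℝ) (x y z : Word H →₀ ℂ) :
    form q x (y + z) = form q x y + form q x z := by
  rw [← form_conj, form_add_left, map_add, form_conj, form_conj]

lemma form_smul_right (q : ℝ) (x y : Word H →₀ ℂ) (r : ℂ) :
    form q x (r • y) = r * form q x y := by
  rw [← form_conj, form_smul_left, map_mul, form_conj, Complex.conj_conj]

lemma form_zero_left (q : ℝ) (y : Word H →₀ ℂ) : form q 0 y = 0 := by simp [form]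

lemma form_zero_right (q : ℝ) (y : Word H →₀ ℂ) : form q y 0 = 0 := by simp [form]

lemma form_single (q : ℝ) (v w : Word H) (a b : ℂ) :
    form q (Finsupp.single v a) (Finsupp.single w b) = conj a * b * wordInner q v w := by
  simp [form]

/-- The creator on formal linear combinations of elementary tensors. -/
def rawCreator (f : H) : (Word H →₀ ℂ) →ₗ[ℂ] (Word H →₀ ℂ) :=
  Finsupp.lmapDomain ℂ ℂ (Word.cons f)

/-- The annihilator on formal linear combinations of elementary tensors. -/
def rawAnnihilator (q : ℝ) (f : H) : (Word H →₀ ℂ) →ₗ[ℂ] (Word H →₀ ℂ) :=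
  Finsupp.linearCombination ℂ (Word.annihilate q f)

lemma rawCreator_single (f : H) (w : Word H) (c : ℂ) :
    rawCreator f (Finsupp.single w c) = Finsupp.single (w.cons f) c := by
  simp [rawCreator, Finsupp.mapDomain_single]

lemma rawAnnihilator_single (q : ℝ) (f : H) (w : Word H) (c : ℂ) :
    rawAnnihilator q f (Finsupp.single w c) = c • Word.annihilate q f w := by
  simp [rawAnnihilator]

lemma form_rawCreator (q : ℝ) (f : H) (x y : Word H →₀ ℂ) :
    form q (rawCreator f x) y = form q x (rawAnnihilator q f y) := by
  induction x using Finsupp.induction_linear with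
  | zero => simp [form_zero_left]
  | add x x' h h' => rw [map_add, form_add_left, form_add_left, h, h']
  | single v a =>
    induction y using Finsupp.induction_linear with
    | zero => simp [form_zero_right]
    | add y y' h h' => rw [map_add, form_add_right, form_add_right, h, h']
    | single w b =>
      rw [rawCreator_single, form_single, wordInner_cons, rawAnnihilator_single, form_smul_right]
      unfold form
      rw [Finsupp.sum_single_index (by simp [Finsupp.sum]), Finsupp.mul_sum, Finsupp.mul_sum]
      exact Finsupp.sum_congr fun u _ => by ring

lemma raw_commutation (q : ℝ) (f g : H) (x : Word H →₀ ℂ) :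
    rawAnnihilator q f (rawCreator g x) =
      (inner ℂ f g : ℂ) • x + (q : ℂ) • rawCreator g (rawAnnihilator q f x) := by
  induction x using Finsupp.induction_linear with
  | zero => simp
  | add x x' h h' => simp only [map_add, h, h', smul_add]; abel
  | single w c =>
    obtain ⟨n, w⟩ := w
    rw [rawCreator_single, rawAnnihilator_single, rawAnnihilator_single, map_smul]
    have key : Word.annihilate q f (Word.cons g ⟨n, w⟩) =
        (inner ℂ f g : ℂ) • Finsupp.single ⟨n, w⟩ (1 : ℂ) +
          (q : ℂ) • rawCreator g (Word.annihilate q f ⟨n, w⟩) := by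
      simp only [Word.cons, Word.annihilate]
      rw [Fin.sum_univ_succ]
      congr 1
      · simp
      · cases n with
        | zero => simp
        | succ n =>
          rw [map_sum, Finset.smul_sum]
          refine Finset.sum_congr rfl fun k _ => ?_
          rw [rawCreator_single, Finsupp.smul_single]
          have hw : (fun i => (Fin.cons g w : Fin (n + 2) → H) (k.succ.succAbove i)) =
              Fin.cons g fun i => w (k.succAbove i) := by
            funext i
            refine Fin.cases ?_ (fun i => ?_) i <;> simp
          rw [hw]
          simp only [Word.cons, Fin.cons_succ, Fin.val_succ, smul_eq_mul]
          congr 1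
          ring
    rw [key, smul_add, smul_comm c, smul_comm c]
    congr 2
    simp

/-- The linear span of the vacuum and of the elementary tensors over `H`, with the (positive
semidefinite) `q`-deformed inner product, for `-1 < q < 1`. Formal combinations that represent the
same tensor have distance zero, and are identified in the completion. -/
def PreFock (_q : Set.Ioo (-1 : ℝ) 1) (H : Type*) := Word H →₀ ℂ

instance (q : Set.Ioo (-1 : ℝ) 1) (H : Type*) : AddCommGroup (PreFock q H) :=
  inferInstanceAs (AddCommGroup (Word H →₀ ℂ))

instance (q : Set.Ioo (-1 : ℝ) 1) (H : Type*) : Module ℂ (PreFock q H) :=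
  inferInstanceAs (Module ℂ (Word H →₀ ℂ))

instance preFockCore (q : Set.Ioo (-1 : ℝ) 1) (H : Type*) [NormedAddCommGroup H]
    [InnerProductSpace ℂ H] : PreInnerProductSpace.Core ℂ (PreFock q H) where
  inner x y := form q x y
  conj_inner_symm x y := form_conj q x y
  re_inner_nonneg x := (Complex.le_def.1 (form_self_nonneg q.2.1.le q.2.2.le x)).1
  add_left x y z := form_add_left q x y z
  smul_left x y r := form_smul_left q x y r

instance (q : Set.Ioo (-1 : ℝ) 1) (H : Type*) [NormedAddCommGroup H]
    [InnerProductSpace ℂ H] : SeminormedAddCommGroup (PreFock q H) :=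
  InnerProductSpace.Core.toSeminormedAddCommGroup (𝕜 := ℂ)

instance (q : Set.Ioo (-1 : ℝ) 1) (H : Type*) [NormedAddCommGroup H]
    [InnerProductSpace ℂ H] : InnerProductSpace ℂ (PreFock q H) :=
  InnerProductSpace.ofCore (preFockCore q H)

/-- The `q`-deformed Fock space over `H`: the (Hausdorff) completion of `PreFock q H`. -/
abbrev Fock (q : Set.Ioo (-1 : ℝ) 1) (H : Type*) [NormedAddCommGroup H]
    [InnerProductSpace ℂ H] := UniformSpace.Completion (PreFock q H)

variable (q : Set.Ioo (-1 : ℝ) 1)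

/-- The elementary tensor of a word, in the pre-Hilbert space. -/
def preTensor (w : Word H) : PreFock q H := Finsupp.single w 1

lemma inner_preTensor (v w : Word H) :
    inner ℂ (preTensor q v) (preTensor q w) = wordInner q v w := by
  change form q (Finsupp.single v 1) (Finsupp.single w 1) = _
  simp [form]

/-- The creator on the pre-Hilbert space. -/
def preCreator (f : H) : PreFock q H →ₗ[ℂ] PreFock q H := rawCreator f

/-- The annihilator on the pre-Hilbert space. -/
def preAnnihilator (f : H) : PreFock q H →ₗ[ℂ] PreFock q H := rawAnnihilator (q : ℝ) f

lemma preCreator_adjoint (f : H) (x y : PreFock q H) :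
    inner ℂ (preCreator q f x) y = inner ℂ x (preAnnihilator q f y) :=
  form_rawCreator q f x y

lemma preCommutation (f g : H) (x : PreFock q H) :
    preAnnihilator q f (preCreator q g x) =
      (inner ℂ f g : ℂ) • x + ((q : ℝ) : ℂ) • preCreator q g (preAnnihilator q f x) :=
  raw_commutation q f g x

lemma norm_preCreator_sq (f : H) (x : PreFock q H) :
    ‖preCreator q f x‖ ^ 2 = ‖f‖ ^ 2 * ‖x‖ ^ 2 + q * ‖preAnnihilator q f x‖ ^ 2 := by
  have h : inner ℂ (preCreator q f x) (preCreator q f x) =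
      (inner ℂ f f : ℂ) * inner ℂ x x +
        ((q : ℝ) : ℂ) * inner ℂ (preAnnihilator q f x) (preAnnihilator q f x) := by
    rw [preCreator_adjoint, preCommutation, inner_add_right, inner_smul_right, inner_smul_right]
    congr 2
    rw [← inner_conj_symm, preCreator_adjoint, inner_conj_symm]
  simp only [inner_self_eq_norm_sq_to_K] at h
  exact Complex.ofReal_injective (by push_cast; exact h)

/-- The constant in the norm bound for creators and annihilators. -/
def bound : ℝ := (1 - |(q : ℝ)|)⁻¹

lemma bound_pos : 0 < bound q := inv_pos.2 (sub_pos.2 (abs_lt.2 q.2))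

lemma bound_eq : 1 + |(q : ℝ)| * bound q = bound q := by
  have : 1 - |(q : ℝ)| ≠ 0 := (sub_pos.2 (abs_lt.2 q.2)).ne'
  unfold bound
  field_simp
  ring

lemma preAnnihilator_le_of (f : H) (x : PreFock q H) {C : ℝ} (hC : 0 ≤ C)
    (h : ‖preCreator q f (preAnnihilator q f x)‖ ^ 2 ≤ C * ‖preAnnihilator q f x‖ ^ 2) :
    ‖preAnnihilator q f x‖ ^ 2 ≤ C * ‖x‖ ^ 2 := by
  set y := preAnnihilator q f x with hy
  have h1 : ‖y‖ ^ 2 ≤ ‖preCreator q f y‖ * ‖x‖ := by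
    have := norm_inner_le_norm (𝕜 := ℂ) (preCreator q f y) x
    rw [preCreator_adjoint, ← hy, inner_self_eq_norm_sq_to_K] at this
    simpa using this
  have h2 : (‖y‖ ^ 2) ^ 2 ≤ (‖y‖ ^ 2) * (C * ‖x‖ ^ 2) := by
    calc (‖y‖ ^ 2) ^ 2 ≤ (‖preCreator q f y‖ * ‖x‖) ^ 2 := by gcongr
      _ = ‖preCreator q f y‖ ^ 2 * ‖x‖ ^ 2 := by ring
      _ ≤ (C * ‖y‖ ^ 2) * ‖x‖ ^ 2 := by gcongr
      _ = _ := by ring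
  rcases (sq_nonneg ‖y‖).eq_or_lt with h0 | h0
  · rw [← h0]; positivity
  · rw [sq (‖y‖ ^ 2)] at h2
    exact le_of_mul_le_mul_left h2 h0

lemma rawAnnihilator_support (q : ℝ) (f : H) (N : ℕ) (x : Word H →₀ ℂ)
    (hx : ∀ w ∈ x.support, w.1 < N + 1) :
    ∀ w ∈ (rawAnnihilator q f x).support, w.1 < N := by
  have h : rawAnnihilator q f x ∈ Finsupp.supported ℂ ℂ {w : Word H | w.1 < N} := by
    rw [rawAnnihilator, Finsupp.linearCombination_apply]
    refine Submodule.sum_mem _ fun w hw => Submodule.smul_mem _ _ ?_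
    have hw := hx w hw
    obtain ⟨n, w⟩ := w
    cases n with
    | zero => exact Submodule.zero_mem _
    | succ n =>
      refine Submodule.sum_mem _ fun k _ => Finsupp.single_mem_supported ℂ _ ?_
      change n < N
      change n + 1 < N + 1 at hw
      omega
  exact fun w hw => (Finsupp.mem_supported ℂ _).1 h hw

lemma preCreator_bound_aux (f : H) (N : ℕ) : ∀ x : PreFock q H,
    (∀ w ∈ Finsupp.support (x : Word H →₀ ℂ), w.1 < N) →
    ‖preCreator q f x‖ ^ 2 ≤ bound q * ‖f‖ ^ 2 * ‖x‖ ^ 2 := by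
  induction N with
  | zero =>
    intro x hx
    have : x = 0 := Finsupp.support_eq_empty.1
      (Finset.eq_empty_of_forall_notMem fun w hw => by simpa using hx w hw)
    subst this; simp
  | succ N ih =>
    intro x hx
    have hmem := rawAnnihilator_support q f N x hx
    have hC : 0 ≤ bound q * ‖f‖ ^ 2 := mul_nonneg (bound_pos q).le (sq_nonneg _)
    have h1 := preAnnihilator_le_of q f x hC (ih _ hmem)
    rw [norm_preCreator_sq]
    calc ‖f‖ ^ 2 * ‖x‖ ^ 2 + q * ‖preAnnihilator q f x‖ ^ 2
        ≤ ‖f‖ ^ 2 * ‖x‖ ^ 2 + |(q : ℝ)| * (bound q * ‖f‖ ^ 2 * ‖x‖ ^ 2) := by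
          gcongr
          exact le_abs_self _
      _ = (1 + |(q : ℝ)| * bound q) * ‖f‖ ^ 2 * ‖x‖ ^ 2 := by ring
      _ = _ := by rw [bound_eq]

lemma preFock_length (x : PreFock q H) :
    ∃ N, ∀ w ∈ Finsupp.support (x : Word H →₀ ℂ), w.1 < N :=
  ⟨(Finsupp.support (x : Word H →₀ ℂ)).sup (fun w => w.1) + 1, fun _ hw =>
    Nat.lt_succ_of_le (Finset.le_sup (f := fun w : Word H => w.1) hw)⟩

lemma norm_preCreator_le (f : H) (x : PreFock q H) :
    ‖preCreator q f x‖ ≤ √(bound q * ‖f‖ ^ 2) * ‖x‖ := by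
  obtain ⟨N, hN⟩ := preFock_length q x
  rw [← Real.sqrt_sq (norm_nonneg x), ← Real.sqrt_mul' _ (sq_nonneg _)]
  exact Real.le_sqrt_of_sq_le (preCreator_bound_aux q f N x hN)

lemma norm_preAnnihilator_le (f : H) (x : PreFock q H) :
    ‖preAnnihilator q f x‖ ≤ √(bound q * ‖f‖ ^ 2) * ‖x‖ := by
  obtain ⟨N, hN⟩ := preFock_length q (preAnnihilator q f x)
  rw [← Real.sqrt_sq (norm_nonneg x), ← Real.sqrt_mul' _ (sq_nonneg _)]
  exact Real.le_sqrt_of_sq_le (preAnnihilator_le_of q f x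
    (mul_nonneg (bound_pos q).le (sq_nonneg _)) (preCreator_bound_aux q f N _ hN))

/-- The creation operator `l†(f)` on the `q`-deformed Fock space. -/
def creator (f : H) : Fock q H →L[ℂ] Fock q H :=
  ((preCreator q f).mkContinuous _ (norm_preCreator_le q f)).completion

/-- The annihilation operator `l(f)` on the `q`-deformed Fock space. -/
def annihilator (f : H) : Fock q H →L[ℂ] Fock q H :=
  ((preAnnihilator q f).mkContinuous _ (norm_preAnnihilator_le q f)).completion

/-- The elementary tensor `f₁ ⊗ ⋯ ⊗ fₙ` in the `q`-deformed Fock space. -/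
def tensor (w : Word H) : Fock q H := (preTensor q w : PreFock q H)

/-- The vacuum vector. -/
def vacuum : Fock q H := tensor q ⟨0, Fin.elim0⟩

lemma creator_coe (f : H) (x : PreFock q H) : creator q f x = (preCreator q f x : PreFock q H) :=
  ContinuousLinearMap.completion_apply_coe _ x

lemma annihilator_coe (f : H) (x : PreFock q H) :
    annihilator q f x = (preAnnihilator q f x : PreFock q H) :=
  ContinuousLinearMap.completion_apply_coe _ x

lemma inner_tensor (v w : Word H) :
    inner ℂ (tensor q v) (tensor q w) = wordInner (q : ℝ) v w := by
  unfold tensor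
  rw [UniformSpace.Completion.inner_coe, inner_preTensor]

lemma creator_tensor (f : H) (w : Word H) :
    creator q f (tensor q w) = tensor q (w.cons f) := by
  unfold tensor
  rw [creator_coe]
  exact congrArg _ (rawCreator_single f w 1)

lemma preAnnihilator_tensor (f : H) (n : ℕ) (w : Fin (n + 1) → H) :
    preAnnihilator q f (preTensor q ⟨n + 1, w⟩) =
      ∑ k : Fin (n + 1), (((q : ℝ) : ℂ) ^ (k : ℕ) * inner ℂ f (w k)) •
        preTensor q ⟨n, fun i => w (k.succAbove i)⟩ := by
  have h : rawAnnihilator (q : ℝ) f (Finsupp.single (⟨n + 1, w⟩ : Word H) 1) =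
      ∑ k : Fin (n + 1), (((q : ℝ) : ℂ) ^ (k : ℕ) * inner ℂ f (w k)) •
        Finsupp.single (⟨n, fun i => w (k.succAbove i)⟩ : Word H) (1 : ℂ) := by
    rw [rawAnnihilator_single, one_smul]
    exact Finset.sum_congr rfl fun k _ => by
      rw [Finsupp.smul_single, smul_eq_mul, mul_one]
  exact h

lemma annihilator_tensor (f : H) (n : ℕ) (w : Fin (n + 1) → H) :
    annihilator q f (tensor q ⟨n + 1, w⟩) =
      ∑ k : Fin (n + 1), (((q : ℝ) : ℂ) ^ (k : ℕ) * inner ℂ f (w k)) •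
        tensor q ⟨n, fun i => w (k.succAbove i)⟩ := by
  unfold tensor
  rw [annihilator_coe, preAnnihilator_tensor]
  change UniformSpace.Completion.toComplL (𝕜 := ℂ) (E := PreFock q H) _ = _
  rw [map_sum]
  exact Finset.sum_congr rfl fun k _ => map_smul _ _ _

lemma annihilator_vacuum (f : H) : annihilator q f (vacuum q) = 0 := by
  unfold vacuum tensor
  rw [annihilator_coe]
  have h : rawAnnihilator (q : ℝ) f (Finsupp.single (⟨0, Fin.elim0⟩ : Word H) 1) = 0 := by
    rw [rawAnnihilator_single]
    exact smul_zero _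
  exact (congrArg _ h).trans UniformSpace.Completion.coe_zero

lemma annihilator_adjoint (f : H) : star (annihilator q f) = creator q f := by
  rw [ContinuousLinearMap.star_eq_adjoint]
  symm
  rw [ContinuousLinearMap.eq_adjoint_iff]
  intro x y
  induction x, y using UniformSpace.Completion.induction_on₂ with
  | hp => exact isClosed_eq (by fun_prop) (by fun_prop)
  | ih x y =>
    rw [creator_coe, annihilator_coe, UniformSpace.Completion.inner_coe,
      UniformSpace.Completion.inner_coe, preCreator_adjoint]

/-- The word `V f₁ ⊗ ⋯ ⊗ V fₙ`. -/
def Word.map (V : H → H) (w : Word H) : Word H := ⟨w.1, fun i => V (w.2 i)⟩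

/-- Linear extension of `Word.map V` to formal linear combinations. -/
def rawMap (V : H → H) : (Word H →₀ ℂ) →ₗ[ℂ] (Word H →₀ ℂ) :=
  Finsupp.lmapDomain ℂ ℂ (Word.map V)

lemma rawMap_single (V : H → H) (w : Word H) (c : ℂ) :
    rawMap V (Finsupp.single w c) = Finsupp.single (w.map V) c := by
  simp [rawMap, Finsupp.mapDomain_single]

lemma form_rawMap (q : ℝ) (V : H →ₗᵢ[ℂ] H) (x y : Word H →₀ ℂ) :
    form q (rawMap V x) (rawMap V y) = form q x y := by
  induction x using Finsupp.induction_linear with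
  | zero => simp [form_zero_left]
  | add x x' h h' => rw [map_add, form_add_left, form_add_left, h, h']
  | single v a =>
    induction y using Finsupp.induction_linear with
    | zero => simp [form_zero_right]
    | add y y' h h' => rw [map_add, form_add_right, form_add_right, h, h']
    | single w b =>
      rw [rawMap_single, rawMap_single, form_single, form_single]
      simp only [wordInner, Word.map, LinearIsometry.inner_map_map]
      rfl

/-- `f₁ ⊗ ⋯ ⊗ fₙ ↦ V f₁ ⊗ ⋯ ⊗ V fₙ` on the pre-Hilbert space, for an isometry `V` of `H`. -/
def preMap (V : H →ₗᵢ[ℂ] H) : PreFock q H →ₗᵢ[ℂ] PreFock q H :=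
  LinearMap.isometryOfInner (𝕜 := ℂ) (E := PreFock q H) (E' := PreFock q H) (rawMap V)
    (fun x y => form_rawMap q V x y)

/-- The operator `f₁ ⊗ ⋯ ⊗ fₙ ↦ V f₁ ⊗ ⋯ ⊗ V fₙ` on the `q`-deformed Fock space. -/
def secondQuant (V : H →ₗᵢ[ℂ] H) : Fock q H →L[ℂ] Fock q H :=
  (preMap q V).toContinuousLinearMap.completion

lemma secondQuant_coe (V : H →ₗᵢ[ℂ] H) (x : PreFock q H) :
    secondQuant q V x = (preMap q V x : PreFock q H) :=
  ContinuousLinearMap.completion_apply_coe _ x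

lemma secondQuant_tensor (V : H →ₗᵢ[ℂ] H) (w : Word H) :
    secondQuant q V (tensor q w) = tensor q (w.map V) := by
  unfold tensor
  rw [secondQuant_coe]
  exact congrArg _ (rawMap_single V w 1)

lemma preFock_induction {P : PreFock q H → Prop} (h0 : P 0)
    (hadd : ∀ x y, P x → P y → P (x + y)) (hs : ∀ (w : Word H) (c : ℂ), P (c • preTensor q w))
    (x : PreFock q H) : P x :=
  Finsupp.induction_linear x h0 hadd (fun w c => by
    have h : (c • Finsupp.single w (1 : ℂ) : Word H →₀ ℂ) = Finsupp.single w c := by simp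
    rw [← h]; exact hs w c)

lemma fock_ext {S T : Fock q H →L[ℂ] Fock q H} (h : ∀ w, S (tensor q w) = T (tensor q w)) :
    S = T := by
  ext z
  induction z using UniformSpace.Completion.induction_on with
  | hp => exact isClosed_eq (by fun_prop) (by fun_prop)
  | ih x =>
    refine preFock_induction q (P := fun x => S (x : Fock q H) = T (x : Fock q H)) ?_ ?_ ?_ x
    · rw [UniformSpace.Completion.coe_zero, map_zero, map_zero]
    · intro x y hx hy
      rw [UniformSpace.Completion.coe_add, map_add, map_add, hx, hy]
    · intro w c
      rw [UniformSpace.Completion.coe_smul, map_smul, map_smul]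
      exact congrArg _ (h w)

lemma inner_secondQuant (V : H →ₗᵢ[ℂ] H) (x y : Fock q H) :
    inner ℂ (secondQuant q V x) (secondQuant q V y) = inner ℂ x y := by
  induction x, y using UniformSpace.Completion.induction_on₂ with
  | hp => exact isClosed_eq (by fun_prop) (by fun_prop)
  | ih x y =>
    rw [secondQuant_coe, secondQuant_coe, UniformSpace.Completion.inner_coe,
      UniformSpace.Completion.inner_coe, LinearIsometry.inner_map_map]

lemma star_secondQuant_mul (V : H →ₗᵢ[ℂ] H) : star (secondQuant q V) * secondQuant q V = 1 := by
  refine ContinuousLinearMap.ext fun x => ext_inner_left ℂ fun y => ?_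
  rw [ContinuousLinearMap.star_eq_adjoint, mul_apply_eq_comp,
    ContinuousLinearMap.adjoint_inner_right, inner_secondQuant]
  rfl

lemma secondQuant_mul_symm (V : H ≃ₗᵢ[ℂ] H) :
    secondQuant q V.toLinearIsometry * secondQuant q V.symm.toLinearIsometry = 1 := by
  refine fock_ext q fun w => ?_
  rw [mul_apply_eq_comp, secondQuant_tensor, secondQuant_tensor]
  simp [Word.map]

/-- For unitary `V`, the unitary operator `f₁ ⊗ ⋯ ⊗ fₙ ↦ V f₁ ⊗ ⋯ ⊗ V fₙ`. -/
def secondQuantUnitary (V : H ≃ₗᵢ[ℂ] H) : unitary (Fock q H →L[ℂ] Fock q H) :=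
  ⟨secondQuant q V.toLinearIsometry, by
    have h1 := star_secondQuant_mul q V.toLinearIsometry
    have h2 := secondQuant_mul_symm q V
    refine ⟨h1, ?_⟩
    rwa [left_inv_eq_right_inv h1 h2]⟩

lemma secondQuant_annihilator (V : H ≃ₗᵢ[ℂ] H) (f : H) :
    (secondQuantUnitary q V : Fock q H →L[ℂ] Fock q H) * annihilator q f *
      star (secondQuantUnitary q V : Fock q H →L[ℂ] Fock q H) = annihilator q (V f) := by
  have key : (secondQuantUnitary q V : Fock q H →L[ℂ] Fock q H) * creator q f =
      creator q (V f) * secondQuantUnitary q V := by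
    refine fock_ext q fun w => ?_
    simp only [secondQuantUnitary, mul_apply_eq_comp, creator_tensor,
      secondQuant_tensor]
    congr 1
    simp only [Word.map, Word.cons]
    congr 1
    funext i
    refine Fin.cases ?_ (fun i => ?_) i <;> simp
  apply star_injective
  rw [star_mul, star_mul, star_star, annihilator_adjoint, annihilator_adjoint, ← mul_assoc, key,
    mul_assoc, Unitary.mul_star_self_of_mem (secondQuantUnitary q V).2, mul_one]

section General

variable {A : Type*} [CStarAlgebra A]

/-- Conjugation by a unitary element, `X ↦ u X u*`. -/
def conjHom (u : unitary A) : A →⋆ₐ[ℂ] A where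
  toFun X := u * X * star (u : A)
  map_one' := by simp
  map_mul' X Y := by
    have h : star (u : A) * u = 1 := Unitary.star_mul_self_of_mem u.2
    calc (u : A) * (X * Y) * star (u : A) = u * X * 1 * Y * star (u : A) := by
          simp only [mul_one, mul_assoc]
      _ = _ := by rw [← h]; simp only [mul_assoc]
  map_zero' := by simp
  map_add' X Y := by simp [mul_add, add_mul]
  commutes' c := by
    rw [← Algebra.commutes, mul_assoc, Unitary.mul_star_self_of_mem u.2, mul_one]
  map_star' X := by simp [mul_assoc]

lemma norm_conjHom (u : unitary A) (X : A) : ‖conjHom u X‖ = ‖X‖ := by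
  change ‖(u : A) * X * star (u : A)‖ = ‖X‖
  rw [← Unitary.coe_star, CStarRing.norm_mul_coe_unitary, CStarRing.norm_coe_unitary_mul]

lemma closure_adjoin_le {a : ℤ → A} {S : StarSubalgebra ℂ A}
    (hS : IsClosed (S : Set A)) (h : ∀ j, a j ∈ S) :
    (StarAlgebra.adjoin ℂ (Set.range a)).topologicalClosure ≤ S :=
  StarSubalgebra.topologicalClosure_minimal
    (StarAlgebra.adjoin_le (by rintro _ ⟨j, rfl⟩; exact h j)) hS

lemma exists_lim {φ : ℕ → A →⋆ₐ[ℂ] A} (hφ : ∀ n X, ‖φ n X‖ = ‖X‖) {a : ℤ → A}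
    (h : ∀ j, ∃ Y, Filter.Tendsto (fun n => φ n (a j)) Filter.atTop (nhds Y)) :
    ∀ X ∈ (StarAlgebra.adjoin ℂ (Set.range a)).topologicalClosure,
      ∃ Y, Filter.Tendsto (fun n => φ n X) Filter.atTop (nhds Y) := by
  let T : StarSubalgebra ℂ A :=
    { carrier := {X | ∃ Y, Filter.Tendsto (fun n => φ n X) Filter.atTop (nhds Y)}
      mul_mem' := by
        rintro X X' ⟨Y, hY⟩ ⟨Y', hY'⟩
        exact ⟨Y * Y', by simpa only [map_mul] using hY.mul hY'⟩
      add_mem' := by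
        rintro X X' ⟨Y, hY⟩ ⟨Y', hY'⟩
        exact ⟨Y + Y', by simpa only [map_add] using hY.add hY'⟩
      algebraMap_mem' := fun c => ⟨algebraMap ℂ _ c, by
        simp only [AlgHomClass.commutes]; exact tendsto_const_nhds⟩
      star_mem' := by
        rintro X ⟨Y, hY⟩
        exact ⟨star Y, by simpa only [map_star] using hY.star⟩ }
  have hT : IsClosed (T : Set A) := by
    refine isClosed_of_closure_subset fun X hX => ?_
    refine cauchySeq_tendsto_of_complete (Metric.cauchySeq_iff'.2 fun ε hε => ?_)
    obtain ⟨X', ⟨Y, hY⟩, hd⟩ := Metric.mem_closure_iff.1 hX (ε / 3) (by positivity)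
    obtain ⟨N, hN⟩ := Metric.cauchySeq_iff'.1 hY.cauchySeq (ε / 3) (by positivity)
    refine ⟨N, fun n hn => ?_⟩
    have hdist : ∀ n, dist (φ n X) (φ n X') < ε / 3 := fun n => by
      rwa [dist_eq_norm, ← map_sub, hφ, ← dist_eq_norm]
    have h1 := hdist n
    have h2 := hdist N
    have h3 := hN n hn
    have h4 := dist_triangle4 (φ n X) (φ n X') (φ N X') (φ N X)
    rw [dist_comm (φ N X')] at h4
    linarith
  exact fun X hX => closure_adjoin_le hT h hX

lemma mem_closure_adjoin (a : ℤ → A) (j : ℤ) :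
    a j ∈ (StarAlgebra.adjoin ℂ (Set.range a)).topologicalClosure :=
  StarSubalgebra.le_topologicalClosure _ (StarAlgebra.subset_adjoin ℂ _ ⟨j, rfl⟩)

lemma exists_limHom (φ : ℕ → A →⋆ₐ[ℂ] A) (hφ : ∀ n X, ‖φ n X‖ = ‖X‖) (a : ℤ → A) (g : ℤ → ℤ)
    (h : ∀ j, ∀ᶠ n in Filter.atTop, φ n (a j) = a (g j))
    (h' : ∀ n j, φ n (a j) ∈ Set.range a) :
    ∃! Λ : (StarAlgebra.adjoin ℂ (Set.range a)).topologicalClosure →⋆ₐ[ℂ]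
        (StarAlgebra.adjoin ℂ (Set.range a)).topologicalClosure,
      ∀ j, Λ ⟨a j, mem_closure_adjoin a j⟩ = ⟨a (g j), mem_closure_adjoin a (g j)⟩ := by
  set R := (StarAlgebra.adjoin ℂ (Set.range a)).topologicalClosure with hR
  have hclosed : IsClosed (R : Set A) := StarSubalgebra.isClosed_topologicalClosure _
  have hgen : ∀ j, Filter.Tendsto (fun n => φ n (a j)) Filter.atTop (nhds (a (g j))) :=
    fun j => tendsto_const_nhds.congr' ((h j).mono fun _ h => h.symm)
  choose L hL using fun X : R => exists_lim hφ (fun j => ⟨_, hgen j⟩) X X.2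
  have huniq : ∀ (X : R) (Y : A),
      Filter.Tendsto (fun n => φ n (X : A)) Filter.atTop (nhds Y) → L X = Y :=
    fun X Y hY => tendsto_nhds_unique (hL X) hY
  let Λ₀ : R →⋆ₐ[ℂ] A :=
    { toFun := L
      map_one' := huniq _ _ (by simp)
      map_mul' := fun X Y => huniq _ _
        (by simpa only [map_mul, MulMemClass.coe_mul] using (hL X).mul (hL Y))
      map_zero' := huniq _ _ (by simp)
      map_add' := fun X Y => huniq _ _
        (by simpa only [map_add, AddMemClass.coe_add] using (hL X).add (hL Y))
      commutes' := fun c => huniq _ _ (by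
        have : ∀ n, φ n (algebraMap ℂ R c : R) = algebraMap ℂ A c :=
          fun n => AlgHomClass.commutes (φ n) c
        simp only [this]
        exact tendsto_const_nhds)
      map_star' := fun X => huniq _ _
        (by simpa only [map_star, StarMemClass.coe_star] using (hL X).star) }
  have hmem : ∀ n, ∀ X ∈ R, φ n X ∈ R := by
    intro n
    have hS : IsClosed ((R.comap (φ n) : StarSubalgebra ℂ A) : Set A) :=
      hclosed.preimage (AddMonoidHomClass.isometry_of_norm (φ n) (hφ n)).continuous
    refine fun X hX => closure_adjoin_le hS (fun j => ?_) hX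
    obtain ⟨i, hi⟩ := h' n j
    change φ n (a j) ∈ R
    rw [← hi]
    exact mem_closure_adjoin a i
  have hLmem : ∀ X, Λ₀ X ∈ R := fun X =>
    hclosed.mem_of_tendsto (hL X) (Filter.Eventually.of_forall fun n => hmem n X X.2)
  have hcont : ∀ Λ : R →⋆ₐ[ℂ] R, Continuous Λ := fun Λ =>
    haveI : IsClosed (R : Set A) := hclosed
    AddMonoidHomClass.continuous_of_bound Λ 1 fun X => by
      simpa only [one_mul] using NonUnitalStarAlgHom.norm_apply_le Λ X
  refine ⟨Λ₀.codRestrict R hLmem, fun j => Subtype.ext (huniq _ _ (hgen j)), fun Λ hΛ => ?_⟩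
  refine StarAlgHom.ext_topologicalClosure (hcont Λ) (hcont _) (StarAlgHom.ext_adjoin ?_)
  rintro ⟨x, hx⟩ ⟨j, rfl⟩
  refine (hΛ j).trans ?_
  exact (Subtype.ext (huniq _ _ (hgen j))).symm

end General

/-- The Hilbert space `ℓ²(ℤ)`. -/
abbrev EllTwo : Type := lp (fun _ : ℤ => ℂ) 2

/-- The canonical orthonormal basis vector `e_j` of `ℓ²(ℤ)`. -/
def basisVec (j : ℤ) : EllTwo := lp.single 2 j 1

lemma memlp_perm (σ : Equiv.Perm ℤ) (f : EllTwo) : Memℓp (fun i => f (σ i)) 2 := by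
  have h := lp.memℓp f
  rw [memℓp_gen_iff (by norm_num)] at h ⊢
  exact σ.summable_iff.2 h

/-- The unitary operator on `ℓ²(ℤ)` with `e_j ↦ e_{σ(j)}`. -/
def permIsometry (σ : Equiv.Perm ℤ) : EllTwo ≃ₗᵢ[ℂ] EllTwo where
  toFun f := ⟨fun i => f (σ.symm i), memlp_perm σ.symm f⟩
  invFun f := ⟨fun i => f (σ i), memlp_perm σ f⟩
  left_inv f := by ext i; simp
  right_inv f := by ext i; simp
  map_add' f g := by ext i; rfl
  map_smul' c f := by ext i; rfl
  norm_map' f := by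
    rw [lp.norm_eq_tsum_rpow (by norm_num), lp.norm_eq_tsum_rpow (by norm_num)]
    congr 1
    exact σ.symm.tsum_eq (fun i => ‖f i‖ ^ (2 : ENNReal).toReal)

lemma permIsometry_basisVec (σ : Equiv.Perm ℤ) (j : ℤ) :
    permIsometry σ (basisVec j) = basisVec (σ j) := by
  ext i
  change (lp.single 2 j (1 : ℂ) : EllTwo) (σ.symm i) = (lp.single 2 (σ j) (1 : ℂ) : EllTwo) i
  by_cases h : i = σ j
  · subst h; simp
  · have : σ.symm i ≠ j := fun h' => h (by rw [← h']; simp)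
    simp [h, this]

/-- The unitary operator `U_σ` on the `q`-deformed Fock space over `ℓ²(ℤ)`; it fixes the vacuum
and sends `e_{i₁} ⊗ ⋯ ⊗ e_{iₖ}` to `e_{σ(i₁)} ⊗ ⋯ ⊗ e_{σ(iₖ)}`. -/
def permUnitary (σ : Equiv.Perm ℤ) : unitary (Fock q EllTwo →L[ℂ] Fock q EllTwo) :=
  secondQuantUnitary q (permIsometry σ)

lemma permUnitary_tensor (σ : Equiv.Perm ℤ) (n : ℕ) (i : Fin n → ℤ) :
    (permUnitary q σ : Fock q EllTwo →L[ℂ] Fock q EllTwo) (tensor q ⟨n, fun k => basisVec (i k)⟩) =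
      tensor q ⟨n, fun k => basisVec (σ (i k))⟩ := by
  refine (secondQuant_tensor q (permIsometry σ).toLinearIsometry _).trans (congrArg _ ?_)
  simp only [Word.map]
  congr 1
  funext k
  exact permIsometry_basisVec σ (i k)

lemma permUnitary_vacuum (σ : Equiv.Perm ℤ) :
    (permUnitary q σ : Fock q EllTwo →L[ℂ] Fock q EllTwo) (vacuum q) = vacuum q := by
  refine (secondQuant_tensor q (permIsometry σ).toLinearIsometry _).trans (congrArg _ ?_)
  simp only [Word.map]
  congr 1
  funext k
  exact k.elim0

/-- The annihilator `l_j = l(e_j)`. -/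
def ann (j : ℤ) : Fock q EllTwo →L[ℂ] Fock q EllTwo := annihilator q (basisVec j)

/-- The unital C⋆-algebra generated by the annihilators `l_j`, `j ∈ ℤ`. -/
def qAlgebra : StarSubalgebra ℂ (Fock q EllTwo →L[ℂ] Fock q EllTwo) :=
  (StarAlgebra.adjoin ℂ (Set.range (ann q))).topologicalClosure

instance : IsClosed (qAlgebra q : Set (Fock q EllTwo →L[ℂ] Fock q EllTwo)) :=
  StarSubalgebra.isClosed_topologicalClosure _

lemma ann_mem (j : ℤ) : ann q j ∈ qAlgebra q :=
  mem_closure_adjoin (ann q) j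

/-- The annihilator `l_j`, as an element of the C⋆-algebra generated by the annihilators. -/
def annGen (j : ℤ) : qAlgebra q := ⟨ann q j, ann_mem q j⟩

lemma perm_ann (σ : Equiv.Perm ℤ) (j : ℤ) :
    conjHom (permUnitary q σ) (ann q j) = ann q (σ j) := by
  exact (secondQuant_annihilator q (permIsometry σ) (basisVec j)).trans
    (congrArg _ (permIsometry_basisVec σ j))

lemma exists_perm (g : ℤ → ℤ) (hg : StrictMono g) (n : ℕ) :
    ∃ σ : Equiv.Perm ℤ, ∀ j ∈ Finset.Icc (-n : ℤ) n, σ j = g j := by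
  obtain ⟨σ, hσ⟩ := Equiv.Perm.exists_extending_pair
    (fun j : Finset.Icc (-n : ℤ) n => (j : ℤ)) (fun j => g j) Subtype.val_injective
    (hg.injective.comp Subtype.val_injective)
  exact ⟨σ, fun j hj => hσ ⟨j, hj⟩⟩

lemma exists_spread (g : ℤ → ℤ) (hg : StrictMono g) :
    ∃! Λ : qAlgebra q →⋆ₐ[ℂ] qAlgebra q, ∀ j, Λ (annGen q j) = annGen q (g j) := by
  choose σ hσ using exists_perm g hg
  refine exists_limHom (fun n => conjHom (permUnitary q (σ n))) (fun n => norm_conjHom _)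
    (ann q) g (fun j => ?_) (fun n j => ⟨_, (perm_ann q (σ n) j).symm⟩)
  filter_upwards [Filter.eventually_ge_atTop j.natAbs] with n hn
  rw [← hσ n j (by rw [Finset.mem_Icc]; omega)]
  exact perm_ann q (σ n) j

/-- The unital `*`-endomorphism `Λ_g` of the C⋆-algebra generated by the annihilators that is
determined by `Λ_g(l_j) = l_{g(j)}`, for strictly increasing `g : ℤ → ℤ`. -/
def spread (g : ℤ → ℤ) (hg : StrictMono g) : qAlgebra q →⋆ₐ[ℂ] qAlgebra q :=
  (exists_spread q g hg).choose

lemma spread_annGen (g : ℤ → ℤ) (hg : StrictMono g) (j : ℤ) :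
    spread q g hg (annGen q j) = annGen q (g j) :=
  (exists_spread q g hg).choose_spec.1 j

end QFock

end

/-! Everything rests on the shift. Let `X` lie in the algebra and let `average u n X` be the mean of
`X` over the first `n` powers of conjugation by the shift unitary `u`. These averages converge in
norm to a scalar, and a shift-fixed `X` equals each of its averages with `n ≥ 1`, so `X` is that
scalar.

Convergence is checked on a dense subspace. By the relation `l_i l_j† = δ_ij + q l_j† l_i`, the
*-algebra generated by the annihilators is spanned by Wick ordered monomials, creators to the left
(`adjoin_subset_wickSpan`). Such a monomial is `1`, or begins with a creator, or has an adjoint that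
begins with a creator, so it suffices to average `l_j† X` with `X` an arbitrary bounded operator.
The average is then `n⁻¹ ∑ l_{j+k}† B_k` with `‖B_k‖ ≤ ‖X‖`. Since the vectors `e_{j+k}` are
orthonormal, the sum over `k < n` has norm at most `(1 - |q|)^{-1/2} √n ‖X‖`
(`norm_sum_creator_mul_le`), and the average is `O(n^{-1/2})`. Averaging is a contraction, so
convergence to scalars passes to the norm closure (`isClosed_scalarAverages`).

The other two invariance conditions imply shift invariance. On the algebra, conjugation by the shift
is the pointwise norm limit of conjugations by finitely supported cycles
(`tendsto_conjHom_windowCycle`), and it coincides with `Λ_g` for `g(j) = j + 1`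
(`coe_spread_add_one`). -/

noncomputable section

namespace QFock

/-! ### Ergodic averages over the powers of conjugation by a unitary. -/

section Averages

variable {A : Type*} [CStarAlgebra A]

lemma conjHom_mul (u v : unitary A) (X : A) :
    conjHom (u * v) X = conjHom u (conjHom v X) := by
  change ((u * v : unitary A) : A) * X * star ((u * v : unitary A) : A) =
    u * (v * X * star (v : A)) * star (u : A)
  simp only [Submonoid.coe_mul, star_mul, mul_assoc]

lemma conjHom_pow_of_fixed {u : unitary A} {X : A} (h : conjHom u X = X) (k : ℕ) :
    conjHom (u ^ k) X = X := by
  induction k with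
  | zero => simp [conjHom]
  | succ k ih => rw [pow_succ, conjHom_mul, h, ih]

/-- The average of `X` over the first `n` powers of the automorphism `X ↦ u X u*`. -/
def average (u : unitary A) (n : ℕ) (X : A) : A :=
  (n : ℂ)⁻¹ • ∑ k ∈ Finset.range n, conjHom (u ^ k) X

lemma average_of_fixed {u : unitary A} {X : A} (h : conjHom u X = X) {n : ℕ} (hn : n ≠ 0) :
    average u n X = X := by
  simp only [average, conjHom_pow_of_fixed h, Finset.sum_const, Finset.card_range]
  rw [← Nat.cast_smul_eq_nsmul ℂ, smul_smul, inv_mul_cancel₀ (by exact_mod_cast hn), one_smul]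

lemma average_add (u : unitary A) (n : ℕ) (X Y : A) :
    average u n (X + Y) = average u n X + average u n Y := by
  simp only [average, map_add, Finset.sum_add_distrib, smul_add]

lemma average_smul (u : unitary A) (n : ℕ) (c : ℂ) (X : A) :
    average u n (c • X) = c • average u n X := by
  simp only [average, map_smul, ← Finset.smul_sum, smul_comm c]

lemma average_star (u : unitary A) (n : ℕ) (X : A) :
    average u n (star X) = star (average u n X) := by
  simp only [average, map_star, star_smul, star_sum]
  simp

lemma norm_average_le (u : unitary A) (n : ℕ) (X : A) : ‖average u n X‖ ≤ ‖X‖ := by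
  rcases eq_or_ne n 0 with rfl | hn
  · simp [average]
  have hn' : (0 : ℝ) < n := by exact_mod_cast Nat.pos_of_ne_zero hn
  rw [average, norm_smul, norm_inv, Complex.norm_natCast, inv_mul_le_iff₀ hn']
  refine (norm_sum_le _ _).trans_eq ?_
  simp only [norm_conjHom, Finset.sum_const, Finset.card_range, nsmul_eq_mul]

/-- The elements whose averages converge to a scalar. -/
def scalarAverages (u : unitary A) : Submodule ℂ A where
  carrier := {X | ∃ c : ℂ, Filter.Tendsto (fun n => average u n X) Filter.atTop (nhds (c • 1))}
  add_mem' := by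
    rintro X Y ⟨c, hc⟩ ⟨d, hd⟩
    exact ⟨c + d, by simpa only [average_add, add_smul] using hc.add hd⟩
  zero_mem' := ⟨0, by simp [average]⟩
  smul_mem' := by
    rintro a X ⟨c, hc⟩
    exact ⟨a * c, by simpa only [average_smul, mul_smul] using hc.const_smul a⟩

lemma one_mem_scalarAverages (u : unitary A) : 1 ∈ scalarAverages u := by
  refine ⟨1, ?_⟩
  rw [one_smul]
  refine tendsto_const_nhds.congr' ?_
  -- The term `n = 0` must be discarded: the empty average is `0`, not `1`.
  filter_upwards [Filter.eventually_ne_atTop 0] with n hn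
  exact (average_of_fixed (map_one _) hn).symm

lemma star_mem_scalarAverages {u : unitary A} {X : A} (h : X ∈ scalarAverages u) :
    star X ∈ scalarAverages u := by
  obtain ⟨c, hc⟩ := h
  exact ⟨star c, by simpa only [average_star, star_smul, star_one] using hc.star⟩

/-- Averaging is linear and contractive uniformly in `n`, so an ε/3 argument makes the averages of a
limit point Cauchy. Their limit is again a scalar because the line `ℂ ∙ 1` is finite dimensional,
hence closed. -/
lemma isClosed_scalarAverages (u : unitary A) : IsClosed (scalarAverages u : Set A) := by
  have hline : IsClosed ((ℂ ∙ (1 : A) : Submodule ℂ A) : Set A) :=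
    Submodule.closed_of_finiteDimensional _
  refine isClosed_of_closure_subset fun X hX => ?_
  have hcauchy : CauchySeq fun n => average u n X := by
    refine Metric.cauchySeq_iff'.2 fun ε hε => ?_
    obtain ⟨Y, ⟨c, hc⟩, hd⟩ := Metric.mem_closure_iff.1 hX (ε / 3) (by positivity)
    obtain ⟨N, hN⟩ := Metric.cauchySeq_iff'.1 hc.cauchySeq (ε / 3) (by positivity)
    refine ⟨N, fun n hn => ?_⟩
    have hdist : ∀ n, dist (average u n X) (average u n Y) < ε / 3 := fun n => by
      refine lt_of_le_of_lt ?_ hd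
      have := norm_average_le u n (X + (-1 : ℂ) • Y)
      rw [average_add, average_smul] at this
      simpa only [dist_eq_norm, sub_eq_add_neg, neg_smul, one_smul] using this
    have h4 := dist_triangle4 (average u n X) (average u n Y) (average u N Y) (average u N X)
    rw [dist_comm (average u N Y)] at h4
    linarith [hdist n, hdist N, hN n hn]
  obtain ⟨Z, hZ⟩ := cauchySeq_tendsto_of_complete hcauchy
  suffices Z ∈ closure ((ℂ ∙ (1 : A) : Submodule ℂ A) : Set A) by
    rw [hline.closure_eq] at this
    obtain ⟨c, rfl⟩ := Submodule.mem_span_singleton.1 this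
    exact ⟨c, hZ⟩
  -- If `Y` is within `ε` of `X` and its averages tend to `c • 1`, contractivity gives `dist Z (c •
  -- 1) ≤ dist X Y < ε`.
  refine Metric.mem_closure_iff.2 fun ε hε => ?_
  obtain ⟨Y, ⟨c, hc⟩, hd⟩ := Metric.mem_closure_iff.1 hX ε hε
  refine ⟨c • 1, Submodule.smul_mem _ _ (Submodule.mem_span_singleton_self _),
    lt_of_le_of_lt (le_of_tendsto' (hZ.dist hc) fun n => ?_) hd⟩
  have := norm_average_le u n (X + (-1 : ℂ) • Y)
  rw [average_add, average_smul] at this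
  simpa only [dist_eq_norm, sub_eq_add_neg, neg_smul, one_smul] using this

lemma exists_smul_one_of_fixed {u : unitary A} {X : A} (hX : X ∈ scalarAverages u)
    (h : conjHom u X = X) : ∃ c : ℂ, X = c • 1 := by
  obtain ⟨c, hc⟩ := hX
  refine ⟨c, tendsto_nhds_unique (tendsto_const_nhds.congr' ?_) hc⟩
  filter_upwards [Filter.eventually_ne_atTop 0] with n hn
  exact (average_of_fixed h hn).symm

end Averages

/-! ### Wick ordering from the `q`-commutation relation. -/

section WickOrder

variable {A : Type*} [Ring A] [StarRing A] [Algebra ℂ A] [StarModule ℂ A]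

/-- The span of the Wick ordered monomials in the elements `a i` and their adjoints. -/
def wickSpan {ι : Type*} (a : ι → A) : Submodule ℂ A :=
  Submodule.span ℂ {X | ∃ x ∈ Submonoid.closure (Set.range fun i => star (a i)),
    ∃ y ∈ Submonoid.closure (Set.range a), X = x * y}

variable {ι : Type*} {a : ι → A}

lemma star_mul_mem_wickSpan (i : ι) {X : A} (hX : X ∈ wickSpan a) :
    star (a i) * X ∈ wickSpan a := by
  induction hX using Submodule.span_induction with
  | mem X hX =>
    obtain ⟨x, hx, y, hy, rfl⟩ := hX
    exact Submodule.subset_span ⟨star (a i) * x,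
      mul_mem (Submonoid.subset_closure ⟨i, rfl⟩) hx, y, hy, (mul_assoc _ _ _).symm⟩
  | zero => simp
  | add X Y _ _ hX hY => rw [mul_add]; exact add_mem hX hY
  | smul c X _ hX => rw [mul_smul_comm]; exact Submodule.smul_mem _ _ hX

/-- The annihilator is moved to the right past one creator at a time. Each exchange leaves a term
with that creator deleted, already Wick ordered, and a term in which the annihilator faces one
creator fewer, covered by the induction. -/
lemma mul_mem_wickSpan {q : ℂ} {δ : ι → ι → ℂ}
    (hcomm : ∀ i j, a i * star (a j) = δ i j • 1 + q • (star (a j) * a i))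
    (i : ι) {X : A} (hX : X ∈ wickSpan a) : a i * X ∈ wickSpan a := by
  induction hX using Submodule.span_induction with
  | mem X hX =>
    obtain ⟨x, hx, y, hy, rfl⟩ := hX
    induction hx using Submonoid.closure_induction_left with
    | one =>
      exact Submodule.subset_span ⟨1, one_mem _, a i * y,
        mul_mem (Submonoid.subset_closure ⟨i, rfl⟩) hy, by simp⟩
    | mul_left s hs x hx ih =>
      obtain ⟨j, rfl⟩ := hs
      have : a i * (star (a j) * x * y) =
          δ i j • (x * y) + q • (star (a j) * (a i * (x * y))) := by
        rw [mul_assoc, ← mul_assoc (a i), hcomm, add_mul, smul_mul_assoc, smul_mul_assoc,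
          one_mul, mul_assoc]
      rw [this]
      exact add_mem (Submodule.smul_mem _ _ (Submodule.subset_span ⟨x, hx, y, hy, rfl⟩))
        (Submodule.smul_mem _ _ (star_mul_mem_wickSpan j ih))
  | zero => simp
  | add X Y _ _ hX hY => rw [mul_add]; exact add_mem hX hY
  | smul c X _ hX => rw [mul_smul_comm]; exact Submodule.smul_mem _ _ hX

/-- The *-algebra is spanned by words in the `a i` and their adjoints, and prepending either kind of
letter preserves the Wick span. -/
lemma adjoin_subset_wickSpan {q : ℂ} {δ : ι → ι → ℂ}
    (hcomm : ∀ i j, a i * star (a j) = δ i j • 1 + q • (star (a j) * a i))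
    {X : A} (hX : X ∈ StarAlgebra.adjoin ℂ (Set.range a)) : X ∈ wickSpan a := by
  rw [← StarSubalgebra.mem_toSubalgebra, StarAlgebra.adjoin_toSubalgebra,
    ← Subalgebra.mem_toSubmodule, Algebra.adjoin_eq_span] at hX
  refine Submodule.span_le.2 (fun x hx => ?_) hX
  induction hx using Submonoid.closure_induction_left with
  | one => exact Submodule.subset_span ⟨1, one_mem _, 1, one_mem _, by simp⟩
  | mul_left s hs x hx ih =>
    rcases hs with ⟨j, rfl⟩ | ⟨j, hj⟩
    · exact mul_mem_wickSpan hcomm j ih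
    · rw [← star_star s, ← hj]
      exact star_mul_mem_wickSpan j ih

/-- A nontrivial Wick monomial either starts with some `star (a i)` or is a product of `a i` only,
and then its adjoint starts so. The factor after the first letter plays no role, which is why `hmul`
allows every `X`. -/
lemma wickSpan_le {T : Submodule ℂ A} (h1 : 1 ∈ T) (hstar : ∀ X ∈ T, star X ∈ T)
    (hmul : ∀ i X, star (a i) * X ∈ T) : wickSpan a ≤ T := by
  refine Submodule.span_le.2 ?_
  rintro _ ⟨x, hx, y, hy, rfl⟩
  induction hx using Submonoid.closure_induction_left with
  | one =>
    induction hy using Submonoid.closure_induction_right with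
    | one => simpa using h1
    | mul_right y hy s hs _ =>
      obtain ⟨j, rfl⟩ := hs
      simpa using hstar _ (hmul j (star y))
  | mul_left s hs x hx _ =>
    obtain ⟨j, rfl⟩ := hs
    rw [mul_assoc]
    exact hmul j _

end WickOrder

/-! ### The commutation relation on Fock space and the norm of a row of creators. -/

variable {H : Type*} [NormedAddCommGroup H] [InnerProductSpace ℂ H] (q : Set.Ioo (-1 : ℝ) 1)

lemma annihilator_mul_creator (f g : H) :
    annihilator q f * creator q g =
      (inner ℂ f g : ℂ) • 1 + ((q : ℝ) : ℂ) • (creator q g * annihilator q f) := by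
  refine fock_ext q fun w => ?_
  simp only [mul_apply_eq_comp, add_apply, smul_apply,
    one_apply_eq_self]
  unfold tensor
  rw [creator_coe, annihilator_coe, annihilator_coe, creator_coe, preCommutation,
    UniformSpace.Completion.coe_add, UniformSpace.Completion.coe_smul,
    UniformSpace.Completion.coe_smul]

lemma inner_creator_left (f : H) (x y : Fock q H) :
    inner ℂ (creator q f x) y = inner ℂ x (annihilator q f y) := by
  rw [← annihilator_adjoint, ContinuousLinearMap.star_eq_adjoint,
    ContinuousLinearMap.adjoint_inner_left]

section RowBound

variable {ι : Type*} [DecidableEq ι] {e : ι → H} {s : Finset ι} {q}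

/-- Duality: the column of annihilators is the adjoint of the row of creators, so it inherits the
bound. Concretely, the hypothesis is tested on `y k = l(e_k) x`, and `⟪z, x⟫ = t` is estimated by
Cauchy–Schwarz. -/
lemma sum_norm_annihilator_sq_le {C : ℝ} (hC : 0 ≤ C)
    (h : ∀ y : ι → Fock q H, ‖∑ k ∈ s, creator q (e k) (y k)‖ ^ 2 ≤ C * ∑ k ∈ s, ‖y k‖ ^ 2)
    (x : Fock q H) : ∑ k ∈ s, ‖annihilator q (e k) x‖ ^ 2 ≤ C * ‖x‖ ^ 2 := by
  set t := ∑ k ∈ s, ‖annihilator q (e k) x‖ ^ 2 with ht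
  have ht0 : 0 ≤ t := Finset.sum_nonneg fun _ _ => sq_nonneg _
  set z := ∑ k ∈ s, creator q (e k) (annihilator q (e k) x)
  have h1 : inner ℂ z x = (t : ℂ) := by
    simp only [z, sum_inner, inner_creator_left, inner_self_eq_norm_sq_to_K, ht]
    push_cast
    rfl
  have h2 : t ≤ ‖z‖ * ‖x‖ := by
    have := norm_inner_le_norm (𝕜 := ℂ) z x
    rwa [h1, Complex.norm_real, Real.norm_of_nonneg ht0] at this
  have h3 : t * t ≤ t * (C * ‖x‖ ^ 2) := by
    calc t * t ≤ (‖z‖ * ‖x‖) * (‖z‖ * ‖x‖) := by gcongr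
      _ = ‖z‖ ^ 2 * ‖x‖ ^ 2 := by ring
      _ ≤ (C * t) * ‖x‖ ^ 2 := by gcongr; exact h _
      _ = _ := by ring
  rcases ht0.eq_or_lt with h0 | h0
  · rw [← h0]; positivity
  · exact le_of_mul_le_mul_left h3 h0

/-- Expanding the square by the commutation relation and orthonormality gives `∑ ‖y_i‖²` plus `q`
times the cross terms `⟪l_j y_i, l_i y_j⟫`. The dual column bound controls the cross terms by `C`,
so any admissible constant `C` may be replaced by `1 + |q| C`. -/
lemma norm_sum_creator_sq_le_step (he : ∀ i j, inner ℂ (e i) (e j) = if i = j then (1 : ℂ) else 0)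
    {C : ℝ} (hC : 0 ≤ C)
    (h : ∀ y : ι → Fock q H, ‖∑ k ∈ s, creator q (e k) (y k)‖ ^ 2 ≤ C * ∑ k ∈ s, ‖y k‖ ^ 2)
    (y : ι → Fock q H) :
    ‖∑ k ∈ s, creator q (e k) (y k)‖ ^ 2 ≤ (1 + |(q : ℝ)| * C) * ∑ k ∈ s, ‖y k‖ ^ 2 := by
  have hexp : inner ℂ (∑ k ∈ s, creator q (e k) (y k)) (∑ k ∈ s, creator q (e k) (y k)) =
      ∑ i ∈ s, (inner ℂ (y i) (y i) : ℂ) + ((q : ℝ) : ℂ) * ∑ i ∈ s, ∑ j ∈ s,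
        inner ℂ (annihilator q (e j) (y i)) (annihilator q (e i) (y j)) := by
    rw [sum_inner, Finset.mul_sum, ← Finset.sum_add_distrib]
    refine Finset.sum_congr rfl fun i hi => ?_
    have hij : ∀ j, inner ℂ (creator q (e i) (y i)) (creator q (e j) (y j)) =
        (if i = j then inner ℂ (y i) (y j) else 0) + ((q : ℝ) : ℂ) *
          inner ℂ (annihilator q (e j) (y i)) (annihilator q (e i) (y j)) := by
      intro j
      have := congrArg (fun T : Fock q H →L[ℂ] Fock q H => T (y j))
        (annihilator_mul_creator q (e i) (e j))
      simp only [mul_apply_eq_comp, add_apply,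
        smul_apply, one_apply_eq_self] at this
      rw [inner_creator_left, this, inner_add_right, inner_smul_right, inner_smul_right, he,
        ← inner_conj_symm (y i) (creator q (e j) _), inner_creator_left, inner_conj_symm]
      simp
    simp only [inner_sum, hij, Finset.sum_add_distrib, Finset.sum_ite_eq, hi, if_true,
      Finset.mul_sum]
  have hcross : ‖∑ i ∈ s, ∑ j ∈ s,
      (inner ℂ (annihilator q (e j) (y i)) (annihilator q (e i) (y j)) : ℂ)‖ ≤
        C * ∑ k ∈ s, ‖y k‖ ^ 2 := by
    set b : ι → ι → ℝ := fun i j => ‖annihilator q (e j) (y i)‖ with hb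
    calc _ ≤ ∑ i ∈ s, ∑ j ∈ s, b i j * b j i :=
          (norm_sum_le _ _).trans (Finset.sum_le_sum fun i _ =>
            (norm_sum_le _ _).trans (Finset.sum_le_sum fun j _ => norm_inner_le_norm _ _))
      -- The two halves have the same double sum after exchanging `i` and `j`, so only `∑ b i j ^ 2`
      -- remains, and for fixed `i` it is the column estimate at `y i`.
      _ ≤ ∑ i ∈ s, ∑ j ∈ s, (b i j ^ 2 / 2 + b j i ^ 2 / 2) :=
          Finset.sum_le_sum fun i _ => Finset.sum_le_sum fun j _ => by
            nlinarith [sq_nonneg (b i j - b j i)]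
      _ = ∑ i ∈ s, ∑ j ∈ s, b i j ^ 2 := by
          simp only [Finset.sum_add_distrib]
          rw [Finset.sum_comm (f := fun i j => b j i ^ 2 / 2), ← Finset.sum_add_distrib]
          refine Finset.sum_congr rfl fun i _ => ?_
          rw [← Finset.sum_add_distrib]
          exact Finset.sum_congr rfl fun j _ => add_halves _
      _ ≤ ∑ i ∈ s, C * ‖y i‖ ^ 2 :=
          Finset.sum_le_sum fun i _ => sum_norm_annihilator_sq_le hC h (y i)
      _ = _ := (Finset.mul_sum _ _ _).symm
  have hnorm := congrArg norm hexp
  rw [inner_self_eq_norm_sq_to_K] at hnorm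
  have hl : ‖((‖∑ k ∈ s, creator q (e k) (y k)‖ : ℂ)) ^ 2‖ =
      ‖∑ k ∈ s, creator q (e k) (y k)‖ ^ 2 := by simp
  have hl' := hl.symm.trans hnorm
  rw [hl']
  refine (norm_add_le _ _).trans ?_
  rw [norm_mul, Complex.norm_real, Real.norm_eq_abs, add_mul, one_mul, mul_assoc]
  gcongr
  refine (norm_sum_le _ _).trans (Finset.sum_le_sum fun i _ => ?_)
  rw [inner_self_eq_norm_sq_to_K]
  simp

/-- The map `C ↦ 1 + |q| C` contracts to its fixed point `bound q`. Iterating from any finite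
constant therefore yields a constant that does not depend on `s`. -/
lemma norm_sum_creator_sq_le (he : ∀ i j, inner ℂ (e i) (e j) = if i = j then (1 : ℂ) else 0)
    (y : ι → Fock q H) :
    ‖∑ k ∈ s, creator q (e k) (y k)‖ ^ 2 ≤ bound q * ∑ k ∈ s, ‖y k‖ ^ 2 := by
  obtain ⟨C, hC, h0⟩ : ∃ C : ℝ, 0 ≤ C ∧ ∀ y : ι → Fock q H,
      ‖∑ k ∈ s, creator q (e k) (y k)‖ ^ 2 ≤ C * ∑ k ∈ s, ‖y k‖ ^ 2 := by
    -- A crude starting constant, from the triangle inequality and Cauchy–Schwarz; it may grow with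
    -- `s`.
    refine ⟨∑ k ∈ s, ‖creator q (e k)‖ ^ 2, Finset.sum_nonneg fun _ _ => sq_nonneg _,
      fun y => ?_⟩
    refine le_trans ?_ (Finset.sum_mul_sq_le_sq_mul_sq s (fun k => ‖creator q (e k)‖)
      fun k => ‖y k‖)
    gcongr
    exact (norm_sum_le _ _).trans
      (Finset.sum_le_sum fun k _ => ContinuousLinearMap.le_opNorm _ _)
  have hb := (bound_pos q).le
  have hq0 : 0 ≤ |(q : ℝ)| := abs_nonneg _
  have hq1 : |(q : ℝ)| < 1 := abs_lt.2 q.2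
  -- Starting from the weaker constant `bound q + C`, the excess over the fixed point after `n`
  -- iterations is exactly `|q|^n C`.
  have hn : ∀ n : ℕ, ∀ y : ι → Fock q H, ‖∑ k ∈ s, creator q (e k) (y k)‖ ^ 2 ≤
      (bound q + |(q : ℝ)| ^ n * C) * ∑ k ∈ s, ‖y k‖ ^ 2 := by
    intro n
    induction n with
    | zero =>
      refine fun y => (h0 y).trans ?_
      gcongr
      simpa using hb
    | succ n ih =>
      have := norm_sum_creator_sq_le_step he (by positivity) ih
      have heq : 1 + |(q : ℝ)| * (bound q + |(q : ℝ)| ^ n * C) =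
          bound q + |(q : ℝ)| ^ (n + 1) * C := by
        linear_combination bound_eq q
      rwa [heq] at this
  have hlim : Filter.Tendsto
      (fun n : ℕ => (bound q + |(q : ℝ)| ^ n * C) * ∑ k ∈ s, ‖y k‖ ^ 2) Filter.atTop
      (nhds ((bound q + 0 * C) * ∑ k ∈ s, ‖y k‖ ^ 2)) :=
    (((tendsto_pow_atTop_nhds_zero_of_lt_one hq0 hq1).mul_const C).const_add _).mul_const _
  rw [zero_mul, add_zero] at hlim
  exact ge_of_tendsto' hlim fun n => hn n y

/-- The gain over the triangle inequality is `√s.card` in place of `s.card`; this is what makes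
averages with weight `1 / s.card` vanish in the limit. -/
lemma norm_sum_creator_mul_le (he : ∀ i j, inner ℂ (e i) (e j) = if i = j then (1 : ℂ) else 0)
    {B : ι → Fock q H →L[ℂ] Fock q H} {M : ℝ} (hB : ∀ k, ‖B k‖ ≤ M) :
    ‖∑ k ∈ s, creator q (e k) * B k‖ ≤ √(bound q) * √s.card * M := by
  rcases s.eq_empty_or_nonempty with rfl | ⟨k₀, _⟩
  · simp
  have hM : 0 ≤ M := (norm_nonneg _).trans (hB k₀)
  refine ContinuousLinearMap.opNorm_le_bound _ (by positivity) fun x => ?_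
  refine abs_le_of_sq_le_sq' ?_ (by positivity) |>.2
  rw [sum_apply]
  refine (norm_sum_creator_sq_le he fun k => B k x).trans ?_
  rw [mul_pow, mul_pow, mul_pow, Real.sq_sqrt (bound_pos q).le, Real.sq_sqrt (Nat.cast_nonneg _),
    mul_assoc, mul_assoc]
  refine mul_le_mul_of_nonneg_left ?_ (bound_pos q).le
  rw [← nsmul_eq_mul, ← Finset.sum_const]
  refine Finset.sum_le_sum fun k _ => ?_
  rw [← mul_pow]
  gcongr
  exact (B k).le_of_opNorm_le (hB k) x

end RowBound

/-! ### Shift averages on the algebra generated by the annihilators. -/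

lemma inner_basisVec (i j : ℤ) :
    inner ℂ (basisVec i) (basisVec j) = if i = j then (1 : ℂ) else 0 := by
  unfold basisVec
  rw [lp.inner_single_left]
  by_cases h : i = j
  · subst h; simp
  · simp [h]

lemma star_ann (j : ℤ) : star (ann q j) = creator q (basisVec j) :=
  annihilator_adjoint q _

lemma ann_mul_star_ann (i j : ℤ) :
    ann q i * star (ann q j) =
      (if i = j then (1 : ℂ) else 0) • 1 + ((q : ℝ) : ℂ) • (star (ann q j) * ann q i) := by
  rw [star_ann, ← inner_basisVec]
  exact annihilator_mul_creator q _ _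

/-- The unitary that implements the shift of the indices. -/
def shiftUnitary : unitary (Fock q EllTwo →L[ℂ] Fock q EllTwo) :=
  permUnitary q (Equiv.addRight (1 : ℤ))

lemma conjHom_shiftUnitary_pow_ann (k : ℕ) (j : ℤ) :
    conjHom (shiftUnitary q ^ k) (ann q j) = ann q (j + k) := by
  induction k generalizing j with
  | zero => simp [conjHom]
  | succ k ih =>
    rw [pow_succ, conjHom_mul, shiftUnitary, perm_ann, ← shiftUnitary, ih]
    congr 1
    simp only [Equiv.coe_addRight]
    push_cast
    ring

/-- The shift turns the leading creator into creators along distinct basis vectors, while the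
remaining factors keep norm `‖X‖`. The row bound then gives decay of order `n^{-1/2}`, so the
limiting scalar is `0`. -/
lemma star_ann_mul_mem_scalarAverages (j : ℤ) (X : Fock q EllTwo →L[ℂ] Fock q EllTwo) :
    star (ann q j) * X ∈ scalarAverages (shiftUnitary q) := by
  refine ⟨0, ?_⟩
  rw [zero_smul]
  have hle : ∀ n : ℕ, ‖average (shiftUnitary q) n (star (ann q j) * X)‖ ≤
      √(bound q) * ‖X‖ * √((n : ℝ)⁻¹) := by
    intro n
    have hsum : ∑ k ∈ Finset.range n, conjHom (shiftUnitary q ^ k) (star (ann q j) * X) =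
        ∑ k ∈ Finset.range n,
          creator q (basisVec (j + k)) * conjHom (shiftUnitary q ^ k) X :=
      Finset.sum_congr rfl fun k _ => by
        rw [map_mul, map_star, conjHom_shiftUnitary_pow_ann, star_ann]
    have h := norm_sum_creator_mul_le (q := q) (s := Finset.range n)
      (e := fun k : ℕ => basisVec (j + k)) (fun i k => by simp [inner_basisVec])
      (B := fun k => conjHom (shiftUnitary q ^ k) X) (fun k => (norm_conjHom _ X).le)
    rw [average, hsum, norm_smul, norm_inv, Complex.norm_natCast]
    refine (mul_le_mul_of_nonneg_left h (by positivity)).trans_eq ?_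
    rw [Finset.card_range, Real.sqrt_inv]
    -- For `n = 0` both sides are `0`; otherwise `n = √n * √n` cancels the factor `√n` of the row
    -- bound.
    rcases eq_or_ne n 0 with rfl | hn
    · simp
    have hn0 : √(n : ℝ) ≠ 0 := Real.sqrt_ne_zero'.2 (by exact_mod_cast Nat.pos_of_ne_zero hn)
    nth_rewrite 1 [← Real.mul_self_sqrt (Nat.cast_nonneg (α := ℝ) n)]
    field_simp
  refine squeeze_zero_norm hle ?_
  have h0 : Filter.Tendsto (fun n : ℕ => √((n : ℝ)⁻¹)) Filter.atTop (nhds (√0)) :=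
    (Real.continuous_sqrt.tendsto 0).comp tendsto_inv_atTop_nhds_zero_nat
  simpa using h0.const_mul (√(bound q) * ‖X‖)

lemma qAlgebra_subset_scalarAverages {X : Fock q EllTwo →L[ℂ] Fock q EllTwo}
    (hX : X ∈ qAlgebra q) : X ∈ scalarAverages (shiftUnitary q) := by
  have hle : (StarAlgebra.adjoin ℂ (Set.range (ann q)) : Set _) ⊆
      (scalarAverages (shiftUnitary q) : Set (Fock q EllTwo →L[ℂ] Fock q EllTwo)) := fun Y hY =>
    wickSpan_le (one_mem_scalarAverages _) (fun _ => star_mem_scalarAverages)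
      (star_ann_mul_mem_scalarAverages q) (adjoin_subset_wickSpan (ann_mul_star_ann q) hY)
  exact closure_minimal hle (isClosed_scalarAverages _) hX

lemma exists_smul_one_of_shift_fixed {X : Fock q EllTwo →L[ℂ] Fock q EllTwo}
    (hX : X ∈ qAlgebra q) (h : conjHom (shiftUnitary q) X = X) : ∃ c : ℂ, X = c • 1 :=
  exists_smul_one_of_fixed (qAlgebra_subset_scalarAverages q hX) h

/-! ### Reduction of finite permutations and increasing maps to the shift. -/

/-- The cyclic permutation of the integers between `-n` and `n + 1`. -/
def windowCycle (n : ℕ) : Equiv.Perm ℤ where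
  toFun j := if -n ≤ j ∧ j ≤ n then j + 1 else if j = n + 1 then -n else j
  invFun j := if -n < j ∧ j ≤ n + 1 then j - 1 else if j = -n then n + 1 else j
  left_inv j := by
    dsimp only
    split_ifs <;> omega
  right_inv j := by
    dsimp only
    split_ifs <;> omega

lemma windowCycle_apply_of_mem {n : ℕ} {j : ℤ} (h : j.natAbs ≤ n) :
    windowCycle n j = j + 1 :=
  if_pos (by omega)

lemma finite_windowCycle_support (n : ℕ) : {j : ℤ | windowCycle n j ≠ j}.Finite := by
  refine (Set.finite_Icc (-n : ℤ) (n + 1)).subset fun j hj => ?_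
  by_contra hmem
  refine hj ?_
  change (if -n ≤ j ∧ j ≤ n then j + 1 else if j = n + 1 then -n else j : ℤ) = j
  rw [Set.mem_Icc] at hmem
  split_ifs <;> omega

/-- On each generator the sequence is eventually equal to its limit, because the cycle agrees with
the shift on `[-n, n]`. The elements for which convergence holds form a *-subalgebra, closed since
all the conjugations are isometric. -/
lemma tendsto_conjHom_windowCycle {X : Fock q EllTwo →L[ℂ] Fock q EllTwo}
    (hX : X ∈ qAlgebra q) :
    Filter.Tendsto (fun n => conjHom (permUnitary q (windowCycle n)) X) Filter.atTop
      (nhds (conjHom (shiftUnitary q) X)) := by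
  have hgen : ∀ j, Filter.Tendsto (fun n => conjHom (permUnitary q (windowCycle n)) (ann q j))
      Filter.atTop (nhds (conjHom (shiftUnitary q) (ann q j))) := fun j => by
    refine tendsto_const_nhds.congr' ?_
    filter_upwards [Filter.eventually_ge_atTop j.natAbs] with n hn
    rw [perm_ann, windowCycle_apply_of_mem hn]
    exact perm_ann q _ j
  let T : StarSubalgebra ℂ (Fock q EllTwo →L[ℂ] Fock q EllTwo) :=
    { carrier := {X | Filter.Tendsto (fun n => conjHom (permUnitary q (windowCycle n)) X)
        Filter.atTop (nhds (conjHom (shiftUnitary q) X))}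
      mul_mem' := fun {X Y} hX hY => by
        simpa only [Set.mem_ofPred_eq, map_mul] using Filter.Tendsto.mul hX hY
      add_mem' := fun {X Y} hX hY => by
        simpa only [Set.mem_ofPred_eq, map_add] using Filter.Tendsto.add hX hY
      algebraMap_mem' := fun c => by
        simp only [Set.mem_ofPred_eq, AlgHomClass.commutes]
        exact tendsto_const_nhds
      star_mem' := fun {X} hX => by
        simpa only [Set.mem_ofPred_eq, map_star] using Filter.Tendsto.star hX }
  have hT : IsClosed (T : Set (Fock q EllTwo →L[ℂ] Fock q EllTwo)) := by
    refine isClosed_of_closure_subset fun X hX => Metric.tendsto_atTop.2 fun ε hε => ?_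
    obtain ⟨Y, hY, hd⟩ := Metric.mem_closure_iff.1 hX (ε / 3) (by positivity)
    obtain ⟨N, hN⟩ := Metric.tendsto_atTop.1 hY (ε / 3) (by positivity)
    refine ⟨N, fun n hn => ?_⟩
    have hdist : ∀ u : unitary (Fock q EllTwo →L[ℂ] Fock q EllTwo),
        dist (conjHom u X) (conjHom u Y) < ε / 3 := fun u => by
      rwa [dist_eq_norm, ← map_sub, norm_conjHom, ← dist_eq_norm]
    have h4 := dist_triangle4 (conjHom (permUnitary q (windowCycle n)) X)
      (conjHom (permUnitary q (windowCycle n)) Y) (conjHom (shiftUnitary q) Y)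
      (conjHom (shiftUnitary q) X)
    rw [dist_comm (conjHom (shiftUnitary q) Y)] at h4
    linarith [hdist (permUnitary q (windowCycle n)), hdist (shiftUnitary q), hN n hn]
  exact closure_adjoin_le hT hgen hX

/-- Both sides are continuous *-homomorphisms on the algebra and agree on the generators. Invariance
under this single endomorphism is thus shift invariance. -/
lemma coe_spread_add_one (hg : StrictMono fun j : ℤ => j + 1) (X : qAlgebra q) :
    (spread q (fun j => j + 1) hg X : Fock q EllTwo →L[ℂ] Fock q EllTwo) =
      conjHom (shiftUnitary q) X := by
  have hcont : Continuous fun Y : qAlgebra q =>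
      (spread q (fun j => j + 1) hg Y : Fock q EllTwo →L[ℂ] Fock q EllTwo) :=
    continuous_subtype_val.comp
      (AddMonoidHomClass.continuous_of_bound (spread q (fun j => j + 1) hg) 1 fun Y => by
        simpa only [one_mul] using NonUnitalStarAlgHom.norm_apply_le (spread q _ hg) Y)
  have hcont' : Continuous fun Y : qAlgebra q =>
      conjHom (shiftUnitary q) (Y : Fock q EllTwo →L[ℂ] Fock q EllTwo) :=
    (AddMonoidHomClass.isometry_of_norm (conjHom (shiftUnitary q))
      (norm_conjHom _)).continuous.comp continuous_subtype_val
  have h : (qAlgebra q).subtype.comp (spread q (fun j => j + 1) hg) =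
      (conjHom (shiftUnitary q)).comp (qAlgebra q).subtype := by
    refine StarAlgHom.ext_topologicalClosure hcont hcont' (StarAlgHom.ext_adjoin ?_)
    rintro ⟨x, hx⟩ ⟨j, rfl⟩
    exact (congrArg Subtype.val (spread_annGen q _ hg j)).trans
      (perm_ann q (Equiv.addRight (1 : ℤ)) j).symm
  exact DFunLike.congr_fun h X

end QFock

end

/-! ### The three fixed point algebras. -/

theorem proposition4p3 (q : Set.Ioo (-1 : ℝ) 1) :
    {X : QFock.Fock q QFock.EllTwo →L[ℂ] QFock.Fock q QFock.EllTwo |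
        X ∈ QFock.qAlgebra q ∧
          ∀ σ : Equiv.Perm ℤ, {i : ℤ | σ i ≠ i}.Finite →
            (QFock.permUnitary q σ : QFock.Fock q QFock.EllTwo →L[ℂ] QFock.Fock q QFock.EllTwo) *
                X * star (QFock.permUnitary q σ :
                  QFock.Fock q QFock.EllTwo →L[ℂ] QFock.Fock q QFock.EllTwo) = X} =
      {X | ∃ c : ℂ, X = c • 1} ∧
    {X : QFock.Fock q QFock.EllTwo →L[ℂ] QFock.Fock q QFock.EllTwo |
        X ∈ QFock.qAlgebra q ∧
          (QFock.permUnitary q (Equiv.addRight (1 : ℤ)) :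
              QFock.Fock q QFock.EllTwo →L[ℂ] QFock.Fock q QFock.EllTwo) *
                X * star (QFock.permUnitary q (Equiv.addRight (1 : ℤ)) :
                  QFock.Fock q QFock.EllTwo →L[ℂ] QFock.Fock q QFock.EllTwo) = X} =
      {X | ∃ c : ℂ, X = c • 1} ∧
    {X : QFock.qAlgebra q |
        ∀ (g : ℤ → ℤ) (hg : StrictMono g), QFock.spread q g hg X = X} =
      {X | ∃ c : ℂ, X = c • 1} := by
  have hscalar : ∀ (u : unitary (QFock.Fock q QFock.EllTwo →L[ℂ] QFock.Fock q QFock.EllTwo))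
      (c : ℂ), QFock.conjHom u (c • 1) = c • 1 := fun u c => by rw [map_smul, map_one]
  have hmem : ∀ c : ℂ,
      (c • 1 : QFock.Fock q QFock.EllTwo →L[ℂ] QFock.Fock q QFock.EllTwo) ∈ QFock.qAlgebra q :=
    fun c => SMulMemClass.smul_mem c (one_mem _)
  refine ⟨Set.ext fun X => ⟨?_, ?_⟩, Set.ext fun X => ⟨?_, ?_⟩, Set.ext fun X => ⟨?_, ?_⟩⟩
  · rintro ⟨hX, hfix⟩
    -- The conjugates of `X` by the cycles are all `X`, yet they converge to the shift conjugate of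
    -- `X`; hence `X` is fixed by the shift.
    refine QFock.exists_smul_one_of_shift_fixed q hX
      (tendsto_nhds_unique (QFock.tendsto_conjHom_windowCycle q hX) ?_)
    refine tendsto_const_nhds.congr fun n => ?_
    exact (hfix _ (QFock.finite_windowCycle_support n)).symm
  · rintro ⟨c, rfl⟩
    exact ⟨hmem c, fun σ _ => hscalar (QFock.permUnitary q σ) c⟩
  · rintro ⟨hX, hfix⟩
    exact QFock.exists_smul_one_of_shift_fixed q hX hfix
  · rintro ⟨c, rfl⟩
    exact ⟨hmem c, hscalar (QFock.shiftUnitary q) c⟩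
  · intro hfix
    -- Among all increasing maps only the translation by `1` is needed.
    have hg : StrictMono fun j : ℤ => j + 1 := fun i j h => by simpa using h
    obtain ⟨c, hc⟩ := QFock.exists_smul_one_of_shift_fixed q X.2
      ((QFock.coe_spread_add_one q hg X).symm.trans (congrArg Subtype.val (hfix _ hg)))
    exact ⟨c, Subtype.ext hc⟩
  · rintro ⟨c, rfl⟩ g hg
    rw [map_smul, map_one]
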